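/- For $N\in\mathbb N$ and $0<W<\tfrac12$, let $\mathcal T_N$ be the operator that sets to zero all entries of a sequence on $\mathbb Z$ outside $\{0,\dots,N-1\}$, and let $\mathcal B_W$ be the operator that restricts the discrete-time Fourier transform $X(f)=\sum_n x[n]e^{-2\pi \mathrm{j} fn}$ of a sequence to $|f|\le W$, i.e. $(\mathcal B_Wx)[n]=\int_{-W}^{W}X(f)e^{2\pi \mathrm{j} fn}\,df$. The discrete prolate spheroidal sequences (DPSS's) are real sequences $s^{(0)}_{N,W},\dots,s^{(N-1)}_{N,W}$ on $\mathbb Z$ which, with eigenvalues $1>\lambda^{(0)}_{N,W}>\dots>\lambda^{(N-1)}_{N,W}>0$, satisfy $\mathcal B_W\mathcal T_N s^{(\ell)}_{N,W}=\lambda^{(\ell)}_{N,W}s^{(\ell)}_{N,W}$ and $\|\mathcal T_Ns^{(\ell)}_{N,W}\|_2=1$. Let $B_{\rm nyq},B_{\rm band}>0$ be such that $J=B_{\rm nyq}/B_{\rm band}$ is an integer, let $0<T_s\le 1/B_{\rm nyq}$, and suppose that $W=B_{\rm band}T_s/2<\tfrac12$. For $0\le i\le J-1$ put $f_i=\bigl(-\tfrac{B_{\rm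 nyq}}2+(i+\tfrac12)B_{\rm band}\bigr)T_s$. For $k\le N$ let $\Psi_i$ be the $N\times k$ matrix with entries $\Psi_i[n,\ell]=e^{2\pi \mathrm{j} f_in}s^{(\ell)}_{N,W}[n]$ for $0\le n<N$, $0\le\ell<k$ (where $\mathrm{j}=\sqrt{-1}$), and let $\Psi=[\Psi_0\ \Psi_1\cdots\Psi_{J-1}]\in\mathbb C^{N\times kJ}$ be the multiband modulated DPSS dictionary. Then the following hold. (a) The DPSS's exist for all $N$ and all $0<W<\tfrac12$. (b) There is an absolute constant $C_1>0$ such that for all $W\in(0,\tfrac12)$ and $\varepsilon\in(0,1)$ there are $C_2>0$ and $N_0\in\mathbb N$, depending only on $W$ and $\varepsilon$, with $$\lambda^{(\ell)}_{N,W}\ge 1-C_1e^{-C_2N}\quad\text{for all integers } 0\le\ell\le 2NW(1-\varepsilon)\text{ and all } N\ge N_0.\qquad(*)$$ (c) Let $\varepsilon\in(0,1)$, and let $C_1,C_2\in\mathbb R$ and $N_0\in\mathbb N$ be any constants for which $(*)$ holds with $W=B_{\rm band}T_s/2$. Let $N\ge\max(N_0,1)$ and $k=\lfloor 2NW(1-\varepsilon)\rfloor$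 (so $k=2NW(1-\varepsilon)$ whenever the latter is an integer), and let $\Psi$ be the dictionary above. Then $D:=kJ<N$, and for all $\alpha\in\mathbb C^{D}\setminus\{0\}$, $$\sqrt{1-3NC_1^{1/2}e^{-C_2N/2}}\ \le\ \frac{\|\Psi\alpha\|_2}{\|\alpha\|_2}\ \le\ \sqrt{1+3NC_1^{1/2}e^{-C_2N/2}},$$ where the left-hand side is read as $0$ if the number under the root is negative. -/

import Mathlib

open scoped BigOperators

noncomputable section

/-- The discrete-time Fourier transform `X(f) = ∑ₙ x[n] e^{-j2πfn}` of a discrete-time signal.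
(Below it is only applied to signals of finite support, for which the sum is finite.) -/
def dtft (x : ℤ → ℂ) (f : ℝ) : ℂ :=
  ∑' n : ℤ, x n * Complex.exp (-(2 * Real.pi * f * n * Complex.I))

/-- The operator `𝓑_W`: restrict the DTFT to the digital frequencies `|f| ≤ W` and return to the
time domain by the inverse DTFT. -/
def bandLimit (W : ℝ) (x : ℤ → ℂ) (n : ℤ) : ℂ :=
  ∫ f in (-W)..W, dtft x f * Complex.exp (2 * Real.pi * f * n * Complex.I)

/-- The operator `𝓣_N`: zero out all entries outside the index range `{0, 1, …, N - 1}`. -/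
def timeLimit (N : ℕ) (x : ℤ → ℂ) (n : ℤ) : ℂ :=
  if 0 ≤ n ∧ n < (N : ℤ) then x n else 0

/-- `s⁽⁰⁾, …, s⁽ᴺ⁻¹⁾` are Discrete Prolate Spheroidal Sequences for the parameters `N` and `W`,
and `lam` are the corresponding eigenvalues. -/
structure IsDPSS (N : ℕ) (W : ℝ) (lam : Fin N → ℝ) (s : Fin N → ℤ → ℝ) : Prop where
  lam_lt_one : ∀ l, lam l < 1
  lam_strictAnti : StrictAnti lam
  lam_pos : ∀ l, 0 < lam l
  eigen : ∀ l, bandLimit W (timeLimit N (fun n => (s l n : ℂ))) =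
    fun n => (lam l : ℂ) * (s l n : ℂ)
  norm_eq_one : ∀ l, Real.sqrt (∑' n : ℤ, ‖timeLimit N (fun m => (s l m : ℂ)) n‖ ^ 2) = 1

/-- The constants `C₁`, `C₂`, `N₀` are valid for the clustering of the DPSS eigenvalues near one:
`λ⁽ˡ⁾ ≥ 1 - C₁ e^{-C₂ N}` for all `l ≤ 2NW(1 - ε)` and all `N ≥ N₀`. -/
def ClusterNearOne (W ε C₁ C₂ : ℝ) (N₀ : ℕ) : Prop :=
  ∀ N : ℕ, N₀ ≤ N → ∀ (lam : Fin N → ℝ) (s : Fin N → ℤ → ℝ), IsDPSS N W lam s →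
    ∀ l : Fin N, ((l : ℕ) : ℝ) ≤ 2 * N * W * (1 - ε) → 1 - C₁ * Real.exp (-(C₂ * N)) ≤ lam l

/-- The `N × N` matrix whose columns are the DPSS vectors, the restrictions of the sequences
`s⁽ˡ⁾` to the indices `0, 1, …, N - 1`. -/
def dpssMatrix {N : ℕ} (s : Fin N → ℤ → ℝ) : Matrix (Fin N) (Fin N) ℂ :=
  Matrix.of fun n l => (s l ((n : ℕ) : ℤ) : ℂ)

/-- The diagonal matrix that modulates a vector by the digital frequency `f`. -/
def modulator (N : ℕ) (f : ℝ) : Matrix (Fin N) (Fin N) ℂ :=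
  Matrix.diagonal fun m => Complex.exp (2 * Real.pi * f * ((m : ℕ) : ℂ) * Complex.I)

/-- The first `k` columns of the modulated DPSS basis. -/
def modulatedBlock {N k : ℕ} (hk : k ≤ N) (f : ℝ) (s : Fin N → ℤ → ℝ) :
    Matrix (Fin N) (Fin k) ℂ :=
  (modulator N f * dpssMatrix s).submatrix id (Fin.castLE hk)

/-- The midpoint `F_i = -B_nyq/2 + (i + 1/2) B_band` of the `i`-th band. -/
def bandCenter (Bnyq Bband : ℝ) (i : ℕ) : ℝ :=
  -Bnyq / 2 + (i + 1 / 2) * Bband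

/-- The multiband modulated DPSS dictionary `Ψ = [Ψ₀ Ψ₁ ⋯ Ψ_{J-1}]`, of size `N × kJ`, with the
block `Ψ_i` modulated to `f_i = F_i T_s`. The column `(i, l)` is the `l`-th column of `Ψ_i`. -/
def multibandDictionary (Bnyq Bband Ts : ℝ) (J : ℕ) {N k : ℕ} (hk : k ≤ N)
    (s : Fin N → ℤ → ℝ) : Matrix (Fin N) (Fin J × Fin k) ℂ :=
  Matrix.of fun n p => modulatedBlock hk (bandCenter Bnyq Bband (p.1 : ℕ) * Ts) s n p.2

end

/-! On indices 0, …, N-1 the eigenvalue equation says that the vector is an eigenvector of the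
symmetric prolate matrix B with entries `prolateKernel W (m - n)`. By Parseval, for a unit vector
the eigenvalue is its energy in [-W, W].

Near-isometry. Columns in one block are orthonormal. For columns in different blocks, the frequency
shift g satisfies 2W ≤ |g| ≤ 1 - 2W, so modulo 1 the bands overlap at most at endpoints. A column
with energy at least 1 - δ in its own band has at most δ in the other, and an inner product against
an eigenvector with eigenvalue β is 1/β times an integral over that eigenvector's band. This bounds
the coherence by 3√δ (`norm_sum_conj_modulate_mul_le`). Entrywise control of the Gram matrix and kJ
< N then give the bounds (`abs_norm_sq_toEuclideanLin_sub_le`).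

Clustering. By minimax (`IsDPSS.one_sub_le_of_linearMap`) it suffices to find a large space of
vectors with little energy outside the band. Trigonometric sums with frequencies j/M, |j| ≤ K₀,
times a box smoothed by r binomial averagings, form such a space: the window's transform carries the
factor ((1 + e^{-2πif})/2)^r, which is exponentially small away from the integers when r is
proportional to N (`IsDPSS.one_sub_lam_le`).

Existence. The difficulty is that the eigenvalues of B are distinct. B commutes with Slepian's
tridiagonal matrix T, whose eigenspaces are lines; so an eigenbasis of T consists of eigenvectors of
B, each even or odd about the midpoint. The polynomial of a T-eigenvector solves a second-order
equation with both exponents zero at e^{2πiW}, so it does not vanish there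
(`eval_ne_zero_of_recurrence`). The commutator of B with the centered index has rank two and is
governed by these band-edge values; a repeated eigenvalue of B would contradict their nonvanishing
(`prolate_eigenvalues_injective`). -/

noncomputable section

open scoped ComplexConjugate

/-! ### Characters, frequency responses and Parseval's identity. -/

/-- The character `e^{j2πfd}`. -/
def fourierChar (f : ℝ) (d : ℤ) : ℂ :=
  Complex.exp (2 * Real.pi * f * d * Complex.I)

theorem fourierChar_eq (f : ℝ) (d : ℤ) :
    fourierChar f d = Complex.exp (((2 * Real.pi * f * d : ℝ) : ℂ) * Complex.I) := by
  simp [fourierChar]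

@[simp] theorem fourierChar_zero (f : ℝ) : fourierChar f 0 = 1 := by
  simp [fourierChar]

theorem fourierChar_add (f : ℝ) (d e : ℤ) :
    fourierChar f (d + e) = fourierChar f d * fourierChar f e := by
  simp only [fourierChar, ← Complex.exp_add]
  push_cast
  ring_nf

theorem fourierChar_add_left (f g : ℝ) (d : ℤ) :
    fourierChar (f + g) d = fourierChar f d * fourierChar g d := by
  simp only [fourierChar, ← Complex.exp_add]
  push_cast
  ring_nf

theorem fourierChar_neg_left (f : ℝ) (d : ℤ) : fourierChar (-f) d = fourierChar f (-d) := by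
  simp [fourierChar]

@[simp] theorem norm_fourierChar (f : ℝ) (d : ℤ) : ‖fourierChar f d‖ = 1 := by
  rw [fourierChar_eq, Complex.norm_exp_ofReal_mul_I]

theorem conj_fourierChar (f : ℝ) (d : ℤ) : conj (fourierChar f d) = fourierChar f (-d) := by
  simp only [fourierChar, ← Complex.exp_conj]
  simp [Complex.conj_ofNat]

theorem fourierChar_mul_neg (f : ℝ) (d : ℤ) : fourierChar f d * fourierChar f (-d) = 1 := by
  rw [← fourierChar_add]; simp

@[fun_prop] theorem continuous_fourierChar (d : ℤ) : Continuous fun f => fourierChar f d := by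
  unfold fourierChar; fun_prop

/-- The discrete-time Fourier transform of a vector indexed by `0, …, N - 1`. -/
def freqResponse {N : ℕ} (v : Fin N → ℂ) (f : ℝ) : ℂ :=
  ∑ n, v n * fourierChar f (-((n : ℕ) : ℤ))

@[fun_prop] theorem continuous_freqResponse {N : ℕ} (v : Fin N → ℂ) :
    Continuous (freqResponse v) := by
  unfold freqResponse; fun_prop

/-- The sinc-type kernel `∫ₐᵇ e^{j2πfd} df`. -/
def bandKernel (a b : ℝ) (d : ℤ) : ℂ := ∫ f in a..b, fourierChar f d

theorem integral_conj_freqResponse_mul {N : ℕ} (a b : ℝ) (u v : Fin N → ℂ) :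
    ∫ f in a..b, conj (freqResponse u f) * freqResponse v f =
      ∑ m, conj (u m) * ∑ n : Fin N, bandKernel a b ((m : ℕ) - (n : ℕ)) * v n := by
  have h : ∀ f, conj (freqResponse u f) * freqResponse v f =
      ∑ m : Fin N, ∑ n : Fin N, conj (u m) * v n * fourierChar f ((m : ℕ) - (n : ℕ)) := by
    intro f
    simp only [freqResponse, map_sum, Finset.sum_mul_sum, map_mul, conj_fourierChar]
    refine Finset.sum_congr rfl fun m _ => Finset.sum_congr rfl fun n _ => ?_
    rw [sub_eq_add_neg, fourierChar_add, neg_neg]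
    ring
  simp only [h]
  rw [intervalIntegral.integral_finsetSum]
  · refine Finset.sum_congr rfl fun m _ => ?_
    rw [intervalIntegral.integral_finsetSum, Finset.mul_sum]
    · refine Finset.sum_congr rfl fun n _ => ?_
      rw [intervalIntegral.integral_const_mul, bandKernel]
      ring
    · intro n _
      exact Continuous.intervalIntegrable (by fun_prop) _ _
  · intro m _
    exact Continuous.intervalIntegrable (by fun_prop) _ _

theorem bandKernel_period (c : ℝ) (d : ℤ) :
    bandKernel c (c + 1) d = if d = 0 then 1 else 0 := by
  unfold bandKernel
  split_ifs with h
  · simp [h]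
  · have hd : (2 * Real.pi * d * Complex.I : ℂ) ≠ 0 := by
      simp [h, Real.pi_ne_zero]
    have : ∀ f : ℝ, fourierChar f d = Complex.exp ((2 * Real.pi * d * Complex.I) * f) := by
      intro f; unfold fourierChar; ring_nf
    simp only [this]
    rw [integral_exp_mul_complex hd]
    have h1 : Complex.exp (2 * Real.pi * d * Complex.I * ((c + 1 : ℝ) : ℂ)) =
        Complex.exp (2 * Real.pi * d * Complex.I * (c : ℂ)) := by
      rw [Complex.exp_eq_exp_iff_exists_int]
      exact ⟨d, by push_cast; ring⟩
    rw [h1, sub_self, zero_div]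

/-- Parseval's identity over any interval of length one. -/
theorem integral_conj_freqResponse_mul_period {N : ℕ} (c : ℝ) (u v : Fin N → ℂ) :
    ∫ f in c..(c + 1), conj (freqResponse u f) * freqResponse v f = ∑ n, conj (u n) * v n := by
  rw [integral_conj_freqResponse_mul]
  refine Finset.sum_congr rfl fun m _ => ?_
  congr 1
  rw [Finset.sum_eq_single m]
  · simp [bandKernel_period]
  · intro n _ hn
    rw [bandKernel_period, if_neg, zero_mul]
    intro h
    exact hn (Fin.ext (by omega))
  · simp

theorem conj_mul_self_eq (z : ℂ) : conj z * z = ((‖z‖ ^ 2 : ℝ) : ℂ) := by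
  rw [mul_comm, Complex.mul_conj, Complex.normSq_eq_norm_sq]

theorem integral_norm_sq_freqResponse_period {N : ℕ} (c : ℝ) (v : Fin N → ℂ) :
    ∫ f in c..(c + 1), ‖freqResponse v f‖ ^ 2 = ∑ n, ‖v n‖ ^ 2 := by
  have := integral_conj_freqResponse_mul_period c v v
  simp only [conj_mul_self_eq] at this
  rw [intervalIntegral.integral_ofReal] at this
  exact_mod_cast this

/-! ### The prolate kernel, and DPSS's as eigenvectors of the prolate matrix. -/

theorem bandKernel_symm (W : ℝ) (d : ℤ) : bandKernel (-W) W (-d) = bandKernel (-W) W d := by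
  unfold bandKernel
  simp only [← fourierChar_neg_left]
  rw [intervalIntegral.integral_comp_neg fun f => fourierChar f d]
  simp

/-- The prolate kernel `sin(2πWd)/(πd)`, the value at `d = 0` being `2W`. -/
def prolateKernel (W : ℝ) (d : ℤ) : ℝ := (bandKernel (-W) W d).re

theorem conj_bandKernel (a b : ℝ) (d : ℤ) : conj (bandKernel a b d) = bandKernel a b (-d) := by
  unfold bandKernel
  simp only [← conj_fourierChar, intervalIntegral, map_sub, integral_conj]

/-- Conjugation reflects `d`, and the symmetric band makes the kernel even, so the kernel is real.
-/
theorem bandKernel_eq_prolateKernel (W : ℝ) (d : ℤ) :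
    bandKernel (-W) W d = (prolateKernel W d : ℂ) := by
  rw [prolateKernel, eq_comm, ← Complex.conj_eq_iff_re, conj_bandKernel, bandKernel_symm]

theorem prolateKernel_neg (W : ℝ) (d : ℤ) : prolateKernel W (-d) = prolateKernel W d := by
  rw [prolateKernel, bandKernel_symm, prolateKernel]

/-- Multiplying by `d` avoids a case distinction at `d = 0`; in this form the kernel enters both
commutator computations below. -/
theorem mul_prolateKernel (W : ℝ) (d : ℤ) :
    d * prolateKernel W d = Real.sin (2 * Real.pi * W * d) / Real.pi := by
  rcases eq_or_ne d 0 with rfl | h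
  · simp
  have hd : (2 * Real.pi * d * Complex.I : ℂ) ≠ 0 := by
    simp [h, Real.pi_ne_zero]
  have hd' : (d : ℂ) ≠ 0 := by exact_mod_cast h
  have hpi : (Real.pi : ℂ) ≠ 0 := by exact_mod_cast Real.pi_ne_zero
  have : ∀ f : ℝ, fourierChar f d = Complex.exp ((2 * Real.pi * d * Complex.I) * f) := by
    intro f; unfold fourierChar; ring_nf
  have key : (d : ℂ) * (prolateKernel W d : ℂ) =
      Complex.sin (2 * Real.pi * W * d) / Real.pi := by
    rw [← bandKernel_eq_prolateKernel, bandKernel]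
    simp only [this]
    rw [integral_exp_mul_complex hd, Complex.sin]
    push_cast
    have e1 : 2 * (Real.pi : ℂ) * d * Complex.I * W = 2 * Real.pi * W * d * Complex.I := by ring
    have e2 : 2 * (Real.pi : ℂ) * d * Complex.I * -W = -(2 * Real.pi * W * d) * Complex.I := by
      ring
    rw [e1, e2]
    field_simp
    rw [Complex.I_sq]
    ring
  exact_mod_cast key

theorem dtft_timeLimit (N : ℕ) (x : ℤ → ℂ) (f : ℝ) :
    dtft (timeLimit N x) f = freqResponse (fun n : Fin N => x ((n : ℕ) : ℤ)) f := by
  unfold dtft freqResponse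
  rw [tsum_eq_sum (s := (Finset.range N).map Nat.castEmbedding)]
  · rw [Finset.sum_map, Finset.sum_range]
    refine Finset.sum_congr rfl fun n _ => ?_
    simp [timeLimit, fourierChar]
  · intro n hn
    rw [timeLimit, if_neg, zero_mul]
    rintro ⟨h0, h1⟩
    apply hn
    simp only [Finset.mem_map, Finset.mem_range]
    exact ⟨n.toNat, by omega, by simp [h0]⟩

/-- The index `n` ranges over all of ℤ: this gives the finite eigenvalue problem, and also the only
possible extension of its eigenvectors beyond 0, …, N-1. -/
theorem bandLimit_timeLimit (N : ℕ) (W : ℝ) (x : ℤ → ℂ) (n : ℤ) :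
    bandLimit W (timeLimit N x) n =
      ∑ m : Fin N, (prolateKernel W (n - (m : ℕ)) : ℂ) * x ((m : ℕ) : ℤ) := by
  unfold bandLimit
  have h : ∀ f : ℝ, dtft (timeLimit N x) f * Complex.exp (2 * Real.pi * f * n * Complex.I) =
      ∑ m : Fin N, x ((m : ℕ) : ℤ) * fourierChar f (n - (m : ℕ)) := by
    intro f
    rw [dtft_timeLimit, freqResponse, Finset.sum_mul]
    refine Finset.sum_congr rfl fun m _ => ?_
    rw [sub_eq_neg_add, fourierChar_add, mul_assoc]
    rfl
  simp only [h]
  rw [intervalIntegral.integral_finsetSum]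
  · refine Finset.sum_congr rfl fun m _ => ?_
    rw [intervalIntegral.integral_const_mul, ← bandKernel_eq_prolateKernel, bandKernel, mul_comm]
  · intro m _
    exact Continuous.intervalIntegrable (by fun_prop) _ _

theorem tsum_norm_sq_timeLimit (N : ℕ) (x : ℤ → ℂ) :
    ∑' n : ℤ, ‖timeLimit N x n‖ ^ 2 = ∑ n : Fin N, ‖x ((n : ℕ) : ℤ)‖ ^ 2 := by
  rw [tsum_eq_sum (s := (Finset.range N).map Nat.castEmbedding)]
  · rw [Finset.sum_map, Finset.sum_range]
    refine Finset.sum_congr rfl fun n _ => ?_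
    simp [timeLimit]
  · intro n hn
    rw [timeLimit, if_neg, norm_zero, zero_pow two_ne_zero]
    rintro ⟨h0, h1⟩
    apply hn
    simp only [Finset.mem_map, Finset.mem_range]
    exact ⟨n.toNat, by omega, by simp [h0]⟩

/-- Vectors with `∑ₙ k(m - n) v[n] = β v[m]` for the prolate kernel `k`. -/
def IsProlateEigenvector {N : ℕ} (W β : ℝ) (v : Fin N → ℝ) : Prop :=
  ∀ m : Fin N, ∑ n : Fin N, prolateKernel W ((m : ℕ) - (n : ℕ)) * v n = β * v m

theorem IsProlateEigenvector.sum_mul_eq_zero {N : ℕ} {W β γ : ℝ} {u v : Fin N → ℝ}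
    (hu : IsProlateEigenvector W β u) (hv : IsProlateEigenvector W γ v) (h : β ≠ γ) :
    ∑ n, u n * v n = 0 := by
  have h1 : β * ∑ n, u n * v n = γ * ∑ n, u n * v n := by
    calc β * ∑ n, u n * v n = ∑ n, (β * u n) * v n := by
          rw [Finset.mul_sum]; exact Finset.sum_congr rfl fun _ _ => by ring
      _ = ∑ n : Fin N, ∑ m : Fin N, prolateKernel W ((n : ℕ) - (m : ℕ)) * u m * v n := by
          refine Finset.sum_congr rfl fun n _ => ?_
          rw [← hu n, Finset.sum_mul]
      _ = ∑ m : Fin N, u m * ∑ n : Fin N, prolateKernel W ((m : ℕ) - (n : ℕ)) * v n := by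
          rw [Finset.sum_comm]
          refine Finset.sum_congr rfl fun m _ => ?_
          rw [Finset.mul_sum]
          refine Finset.sum_congr rfl fun n _ => ?_
          rw [← prolateKernel_neg, neg_sub]
          ring
      _ = γ * ∑ n, u n * v n := by
          rw [Finset.mul_sum]
          refine Finset.sum_congr rfl fun m _ => ?_
          rw [hv m]; ring
  have h2 : (β - γ) * ∑ n, u n * v n = 0 := by linarith
  exact (mul_eq_zero.mp h2).resolve_left (sub_ne_zero.mpr h)

theorem IsDPSS.isProlateEigenvector {N : ℕ} {W : ℝ} {lam : Fin N → ℝ} {s : Fin N → ℤ → ℝ}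
    (h : IsDPSS N W lam s) (l : Fin N) :
    IsProlateEigenvector W (lam l) fun n : Fin N => s l ((n : ℕ) : ℤ) := by
  intro m
  have := congrFun (h.eigen l) ((m : ℕ) : ℤ)
  rw [bandLimit_timeLimit] at this
  exact_mod_cast this

theorem IsDPSS.sum_sq {N : ℕ} {W : ℝ} {lam : Fin N → ℝ} {s : Fin N → ℤ → ℝ}
    (h : IsDPSS N W lam s) (l : Fin N) : ∑ n : Fin N, s l ((n : ℕ) : ℤ) ^ 2 = 1 := by
  have := h.norm_eq_one l
  rw [Real.sqrt_eq_one, tsum_norm_sq_timeLimit] at this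
  simpa using this

theorem IsDPSS.sum_mul {N : ℕ} {W : ℝ} {lam : Fin N → ℝ} {s : Fin N → ℤ → ℝ}
    (h : IsDPSS N W lam s) (l l' : Fin N) :
    ∑ n : Fin N, s l ((n : ℕ) : ℤ) * s l' ((n : ℕ) : ℤ) = if l = l' then 1 else 0 := by
  split_ifs with hl
  · subst hl
    rw [← h.sum_sq l]
    exact Finset.sum_congr rfl fun _ _ => by ring
  · exact (h.isProlateEigenvector l).sum_mul_eq_zero (h.isProlateEigenvector l')
      (h.lam_strictAnti.injective.ne hl)

/-- Pairing with a prolate eigenvector inside the band `[-W, W]` multiplies the inner product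
by the eigenvalue. -/
theorem IsProlateEigenvector.integral_conj_mul {N : ℕ} {W β : ℝ} {v : Fin N → ℝ}
    (hv : IsProlateEigenvector W β v) (u : Fin N → ℂ) :
    ∫ f in (-W)..W, conj (freqResponse u f) * freqResponse (fun n => (v n : ℂ)) f =
      β * ∑ n, conj (u n) * v n := by
  rw [integral_conj_freqResponse_mul, Finset.mul_sum]
  refine Finset.sum_congr rfl fun m _ => ?_
  have : ∑ n : Fin N, bandKernel (-W) W ((m : ℕ) - (n : ℕ)) * (v n : ℂ) = β * v m := by
    simp only [bandKernel_eq_prolateKernel]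
    exact_mod_cast hv m
  rw [this]
  ring

theorem IsProlateEigenvector.integral_norm_sq {N : ℕ} {W β : ℝ} {v : Fin N → ℝ}
    (hv : IsProlateEigenvector W β v) :
    ∫ f in (-W)..W, ‖freqResponse (fun n => (v n : ℂ)) f‖ ^ 2 = β * ∑ n, v n ^ 2 := by
  have := hv.integral_conj_mul (fun n => (v n : ℂ))
  simp only [conj_mul_self_eq] at this
  rw [intervalIntegral.integral_ofReal] at this
  simp only [Complex.norm_real, Real.norm_eq_abs, sq_abs] at this
  exact_mod_cast this

/-! ### Near-orthogonality of modulated vectors in disjoint bands. -/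

/-- Modulation of a finite vector by the digital frequency `f`. -/
def modulate {N : ℕ} (f : ℝ) (v : Fin N → ℂ) (n : Fin N) : ℂ :=
  fourierChar f ((n : ℕ) : ℤ) * v n

theorem freqResponse_modulate {N : ℕ} (g f : ℝ) (v : Fin N → ℂ) :
    freqResponse (modulate g v) f = freqResponse v (f - g) := by
  unfold freqResponse modulate
  refine Finset.sum_congr rfl fun n _ => ?_
  rw [sub_eq_add_neg, fourierChar_add_left, fourierChar_neg_left, neg_neg]
  ring

theorem sum_conj_modulate_mul_modulate {N : ℕ} (f g : ℝ) (u v : Fin N → ℂ) :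
    ∑ n, conj (modulate f u n) * modulate g v n = ∑ n, conj (modulate (f - g) u n) * v n := by
  refine Finset.sum_congr rfl fun n _ => ?_
  simp only [modulate, map_mul, conj_fourierChar]
  rw [sub_eq_add_neg, fourierChar_add_left, fourierChar_neg_left, neg_neg]
  ring

theorem IsProlateEigenvector.integral_norm_sq_modulate {N : ℕ} {W β : ℝ} {v : Fin N → ℝ}
    (hv : IsProlateEigenvector W β v) (h1 : ∑ n, v n ^ 2 = 1) (g : ℝ) :
    ∫ f in (g - W)..(g + W), ‖freqResponse (modulate g fun n => (v n : ℂ)) f‖ ^ 2 = β := by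
  simp only [freqResponse_modulate]
  rw [intervalIntegral.integral_comp_sub_right
    (fun f => ‖freqResponse (fun n => (v n : ℂ)) f‖ ^ 2)]
  have e1 : g - W - g = -W := by ring
  have e2 : g + W - g = W := by ring
  rw [e1, e2, hv.integral_norm_sq, h1, mul_one]

theorem intervalIntegrable_norm_sq_freqResponse {N : ℕ} (v : Fin N → ℂ) (a b : ℝ) :
    IntervalIntegrable (fun f => ‖freqResponse v f‖ ^ 2) MeasureTheory.volume a b :=
  Continuous.intervalIntegrable (by fun_prop) _ _

theorem integral_norm_sq_freqResponse_nonneg {N : ℕ} (v : Fin N → ℂ) {a b : ℝ} (h : a ≤ b) :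
    0 ≤ ∫ f in a..b, ‖freqResponse v f‖ ^ 2 :=
  intervalIntegral.integral_nonneg h fun _ _ => by positivity

/-- Two disjoint bands inside an interval of length one carry at most the total energy. -/
theorem integral_norm_sq_add_le {N : ℕ} (v : Fin N → ℂ) {a b c d e : ℝ} (hea : e ≤ a)
    (hbc : b ≤ c) (hd : d ≤ e + 1) :
    (∫ f in a..b, ‖freqResponse v f‖ ^ 2) + ∫ f in c..d, ‖freqResponse v f‖ ^ 2 ≤
      ∑ n, ‖v n‖ ^ 2 := by
  have I := intervalIntegrable_norm_sq_freqResponse v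
  rw [← integral_norm_sq_freqResponse_period e v,
    ← intervalIntegral.integral_add_adjacent_intervals (I e a) (I a (e + 1)),
    ← intervalIntegral.integral_add_adjacent_intervals (I a b) (I b (e + 1)),
    ← intervalIntegral.integral_add_adjacent_intervals (I b c) (I c (e + 1)),
    ← intervalIntegral.integral_add_adjacent_intervals (I c d) (I d (e + 1))]
  have h1 := integral_norm_sq_freqResponse_nonneg v hea
  have h2 := integral_norm_sq_freqResponse_nonneg v hbc
  have h3 := integral_norm_sq_freqResponse_nonneg v hd
  linarith

theorem sum_norm_sq_modulate {N : ℕ} (g : ℝ) (v : Fin N → ℂ) :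
    ∑ n, ‖modulate g v n‖ ^ 2 = ∑ n, ‖v n‖ ^ 2 := by
  simp [modulate]

theorem norm_sum_conj_mul_le_one {N : ℕ} {u v : Fin N → ℂ} (hu : ∑ n, ‖u n‖ ^ 2 = 1)
    (hv : ∑ n, ‖v n‖ ^ 2 = 1) : ‖∑ n, conj (u n) * v n‖ ≤ 1 := by
  calc ‖∑ n, conj (u n) * v n‖ ≤ ∑ n, ‖conj (u n) * v n‖ := norm_sum_le _ _
    _ ≤ ∑ n, (‖u n‖ ^ 2 + ‖v n‖ ^ 2) / 2 := by
        refine Finset.sum_le_sum fun n _ => ?_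
        rw [norm_mul, RCLike.norm_conj]
        nlinarith [sq_nonneg (‖u n‖ - ‖v n‖)]
    _ = 1 := by rw [← Finset.sum_div, Finset.sum_add_distrib, hu, hv]; norm_num

/-- Well-concentrated vectors in disjoint bands are nearly orthogonal. -/
theorem norm_sum_conj_modulate_mul_le {N : ℕ} {W g β γ δ : ℝ} {u v : Fin N → ℝ} (hW : 0 ≤ W)
    (hδ : 0 < δ) (hu : IsProlateEigenvector W β u) (hv : IsProlateEigenvector W γ v)
    (hu1 : ∑ n, u n ^ 2 = 1) (hv1 : ∑ n, v n ^ 2 = 1) (hβ : 1 - δ ≤ β) (hβ1 : β ≤ 1)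
    (hγ : 1 - δ ≤ γ) (hg : 2 * W ≤ |g|) (hg1 : |g| + 2 * W ≤ 1) :
    ‖∑ n, conj (modulate g (fun n => (v n : ℂ)) n) * u n‖ ≤ 3 * Real.sqrt δ := by
  set X := modulate g (fun n => (v n : ℂ)) with hX
  have hXn : ∑ n, ‖X n‖ ^ 2 = 1 := by
    rw [hX, sum_norm_sq_modulate]; simpa using hv1
  have hun : ∑ n, ‖(u n : ℂ)‖ ^ 2 = 1 := by simpa using hu1
  have hle1 := norm_sum_conj_mul_le_one hXn hun
  set r := Real.sqrt δ with hr
  have hr0 : 0 < r := Real.sqrt_pos.mpr hδ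
  have hr2 : r ^ 2 = δ := Real.sq_sqrt hδ.le
  -- For β < 1/3 one has δ > 2/3, hence 3√δ ≥ 1, and Cauchy–Schwarz suffices. Otherwise division by
  -- β costs at most the factor 3.
  rcases lt_or_ge β (1 / 3) with h | h
  · have : 1 ≤ 3 * r := by nlinarith
    linarith
  have hout : ∫ f in (-W)..W, ‖freqResponse X f‖ ^ 2 ≤ δ := by
    have hin := hv.integral_norm_sq_modulate hv1 g
    rw [← hX] at hin
    -- A single period must contain both bands: [-W, 1-W] for g ≥ 0 and [W-1, W] for g < 0.
    rcases abs_cases g with ⟨ha, _⟩ | ⟨ha, _⟩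
    · have := integral_norm_sq_add_le X (a := -W) (b := W) (c := g - W) (d := g + W)
        (e := -W) le_rfl (by linarith) (by linarith)
      linarith
    · have := integral_norm_sq_add_le X (a := g - W) (b := g + W) (c := -W) (d := W)
        (e := W - 1) (by linarith) (by linarith) (by linarith)
      linarith
  have hU := hu.integral_norm_sq
  rw [hu1, mul_one] at hU
  have key : β * ‖∑ n, conj (X n) * u n‖ ≤ r := by
    calc β * ‖∑ n, conj (X n) * u n‖ = ‖(β : ℂ) * ∑ n, conj (X n) * u n‖ := by
          rw [norm_mul, Complex.norm_real, Real.norm_of_nonneg (by linarith)]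
      _ = ‖∫ f in (-W)..W, conj (freqResponse X f) * freqResponse (fun n => (u n : ℂ)) f‖ := by
          rw [hu.integral_conj_mul]
      _ ≤ ∫ f in (-W)..W, ‖conj (freqResponse X f) * freqResponse (fun n => (u n : ℂ)) f‖ :=
          intervalIntegral.norm_integral_le_integral_norm (by linarith)
      -- Young's inequality with weight r = √δ, which balances an energy of at most δ against one of
      -- at most 1.
      _ ≤ ∫ f in (-W)..W, ((1 / (2 * r)) * ‖freqResponse X f‖ ^ 2 +
            (r / 2) * ‖freqResponse (fun n => (u n : ℂ)) f‖ ^ 2) := by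
          refine intervalIntegral.integral_mono_on (by linarith)
            (Continuous.intervalIntegrable (by fun_prop) _ _)
            (Continuous.intervalIntegrable (by fun_prop) _ _) fun f _ => ?_
          rw [norm_mul, RCLike.norm_conj]
          set p := ‖freqResponse X f‖
          set q := ‖freqResponse (fun n => (u n : ℂ)) f‖
          have : 1 / (2 * r) * p ^ 2 + r / 2 * q ^ 2 - p * q = (p - r * q) ^ 2 / (2 * r) := by
            field_simp; ring
          have h0 : 0 ≤ (p - r * q) ^ 2 / (2 * r) := by positivity
          linarith
      _ = (1 / (2 * r)) * (∫ f in (-W)..W, ‖freqResponse X f‖ ^ 2) + (r / 2) * β := by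
          rw [intervalIntegral.integral_add, intervalIntegral.integral_const_mul,
            intervalIntegral.integral_const_mul, hU]
          · exact Continuous.intervalIntegrable (by fun_prop) _ _
          · exact Continuous.intervalIntegrable (by fun_prop) _ _
      _ ≤ (1 / (2 * r)) * r ^ 2 + (r / 2) * 1 := by
          rw [hr2]; gcongr
      _ = r := by field_simp; ring
  have h0 := norm_nonneg (∑ n, conj (X n) * (u n : ℂ))
  nlinarith

/-! ### From coherence to the near-isometry of the dictionary. -/

/-- A matrix whose columns have unit norm and pairwise coherence at most `μ` is a near-isometry. -/
theorem abs_norm_sq_toEuclideanLin_sub_le {m n : Type*} [Fintype m] [Fintype n] [DecidableEq n]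
    (A : Matrix m n ℂ) {μ : ℝ} (hdiag : ∀ p, ∑ i, conj (A i p) * A i p = 1)
    (hoff : ∀ p q, p ≠ q → ‖∑ i, conj (A i p) * A i q‖ ≤ μ) (hμ : 0 ≤ μ)
    (α : EuclideanSpace ℂ n) :
    |‖Matrix.toEuclideanLin A α‖ ^ 2 - ‖α‖ ^ 2| ≤ μ * Fintype.card n * ‖α‖ ^ 2 := by
  have hexp : ((‖Matrix.toEuclideanLin A α‖ ^ 2 : ℝ) : ℂ) =
      ∑ p, ∑ q, conj (α p) * α q * ∑ i, conj (A i p) * A i q := by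
    rw [EuclideanSpace.norm_sq_eq]
    push_cast
    have h : ∀ i, ((‖Matrix.toEuclideanLin A α i‖ : ℂ)) ^ 2 =
        ∑ p, ∑ q, conj (α p) * α q * (conj (A i p) * A i q) := by
      intro i
      have := conj_mul_self_eq (Matrix.toEuclideanLin A α i)
      push_cast at this
      rw [← this]
      have h2 : Matrix.toEuclideanLin A α i = ∑ p, A i p * α p := by
        simp [Matrix.mulVec, dotProduct]
      rw [h2, map_sum, Finset.sum_mul_sum]
      refine Finset.sum_congr rfl fun p _ => Finset.sum_congr rfl fun q _ => ?_
      rw [map_mul]; ring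
    simp only [h, Finset.mul_sum]
    rw [Finset.sum_comm]
    refine Finset.sum_congr rfl fun p _ => ?_
    rw [Finset.sum_comm]
  have hα : ((‖α‖ ^ 2 : ℝ) : ℂ) =
      ∑ p, ∑ q, conj (α p) * α q * (if p = q then 1 else 0) := by
    rw [EuclideanSpace.norm_sq_eq]
    push_cast
    refine Finset.sum_congr rfl fun p _ => ?_
    have := conj_mul_self_eq (α p)
    push_cast at this
    rw [← this]
    simp
  have hcs : (∑ p, ‖α p‖) ^ 2 ≤ Fintype.card n * ‖α‖ ^ 2 := by
    rw [EuclideanSpace.norm_sq_eq]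
    exact sq_sum_le_card_mul_sum_sq
  have : |‖Matrix.toEuclideanLin A α‖ ^ 2 - ‖α‖ ^ 2| =
      ‖((‖Matrix.toEuclideanLin A α‖ ^ 2 : ℝ) : ℂ) - ((‖α‖ ^ 2 : ℝ) : ℂ)‖ := by
    rw [← Complex.ofReal_sub, Complex.norm_real, Real.norm_eq_abs]
  rw [this, hexp, hα, ← Finset.sum_sub_distrib]
  simp only [← Finset.sum_sub_distrib, ← mul_sub]
  calc _ ≤ ∑ p, ∑ q, ‖α p‖ * ‖α q‖ * μ := by
        refine (norm_sum_le _ _).trans (Finset.sum_le_sum fun p _ =>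
          (norm_sum_le _ _).trans (Finset.sum_le_sum fun q _ => ?_))
        rw [norm_mul, norm_mul, RCLike.norm_conj]
        gcongr
        split_ifs with hpq
        · subst hpq; simp [hdiag, hμ]
        · simpa using hoff p q hpq
    _ = μ * (∑ p, ‖α p‖) ^ 2 := by
        rw [sq, Finset.sum_mul_sum, Finset.mul_sum]
        refine Finset.sum_congr rfl fun p _ => ?_
        rw [Finset.mul_sum]
        exact Finset.sum_congr rfl fun q _ => by ring
    _ ≤ μ * Fintype.card n * ‖α‖ ^ 2 := by
        rw [mul_assoc]; gcongr

theorem multibandDictionary_apply (Bnyq Bband Ts : ℝ) (J : ℕ) {N k : ℕ} (hk : k ≤ N)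
    (s : Fin N → ℤ → ℝ) (n : Fin N) (p : Fin J × Fin k) :
    multibandDictionary Bnyq Bband Ts J hk s n p =
      modulate (bandCenter Bnyq Bband (p.1 : ℕ) * Ts)
        (fun n => (s (Fin.castLE hk p.2) ((n : ℕ) : ℤ) : ℂ)) n := by
  simp [multibandDictionary, modulatedBlock, modulator, dpssMatrix, modulate, fourierChar]

theorem multibandDictionary_near_isometry (Bnyq Bband Ts W ε C₁ C₂ : ℝ) (J N₀ N k : ℕ)
    (hkN : k ≤ N) (lam : Fin N → ℝ) (s : Fin N → ℤ → ℝ) (hBnyq : 0 < Bnyq)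
    (hBband : 0 < Bband) (hJ : (J : ℝ) = Bnyq / Bband) (hTs : 0 < Ts) (hTs1 : Ts ≤ 1 / Bnyq)
    (hW : W = Bband * Ts / 2) (hε0 : 0 < ε) (hε1 : ε < 1)
    (hC : ClusterNearOne W ε C₁ C₂ N₀) (hN1 : 1 ≤ N) (hN0 : N₀ ≤ N) (hs : IsDPSS N W lam s)
    (hk : k = ⌊2 * N * W * (1 - ε)⌋₊) :
    k * J < N ∧
      ∀ α : EuclideanSpace ℂ (Fin J × Fin k), α ≠ 0 →
        Real.sqrt (1 - 3 * N * Real.sqrt C₁ * Real.exp (-(C₂ * N / 2))) ≤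
          ‖Matrix.toEuclideanLin (multibandDictionary Bnyq Bband Ts J hkN s) α‖ / ‖α‖ ∧
        ‖Matrix.toEuclideanLin (multibandDictionary Bnyq Bband Ts J hkN s) α‖ / ‖α‖ ≤
          Real.sqrt (1 + 3 * N * Real.sqrt C₁ * Real.exp (-(C₂ * N / 2))) := by
  have hNpos : (0 : ℝ) < N := by exact_mod_cast hN1
  have hWpos : 0 < W := by rw [hW]; positivity
  have hJB : J * Bband = Bnyq := by rw [hJ]; field_simp
  have hBT : Bnyq * Ts ≤ 1 := by rwa [le_div_iff₀ hBnyq, mul_comm] at hTs1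
  have h2JW : 2 * W * J ≤ 1 := by
    have : 2 * W * J = J * Bband * Ts := by rw [hW]; ring
    rw [this, hJB]; exact hBT
  have hx0 : 0 ≤ 2 * N * W * (1 - ε) := by
    have : 0 < 1 - ε := by linarith
    positivity
  have hkle : (k : ℝ) ≤ 2 * N * W * (1 - ε) := by rw [hk]; exact Nat.floor_le hx0
  have hkJ : k * J < N := by
    have : (k * J : ℝ) < N := by
      calc (k * J : ℝ) ≤ 2 * N * W * (1 - ε) * J := by gcongr
        _ = N * (1 - ε) * (2 * W * J) := by ring
        _ ≤ N * (1 - ε) * 1 := by gcongr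
        _ < N := by nlinarith
    exact_mod_cast this
  refine ⟨hkJ, fun α hα => ?_⟩
  set δ := C₁ * Real.exp (-(C₂ * N)) with hδ
  have hlam : ∀ l : Fin N, (l : ℕ) ≤ k → 1 - δ ≤ lam l := fun l hl =>
    hC N hN0 lam s hs l ((Nat.cast_le.mpr hl).trans hkle)
  -- Positivity is forced by 1 - δ ≤ λ⁽⁰⁾ < 1; no sign of `C₁` is assumed.
  have hδ0 : 0 < δ := by
    have h1 := hlam ⟨0, hN1⟩ (Nat.zero_le _)
    have h2 := hs.lam_lt_one ⟨0, hN1⟩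
    linarith
  have hsq : Real.sqrt δ = Real.sqrt C₁ * Real.exp (-(C₂ * N / 2)) := by
    rw [hδ, Real.sqrt_mul' _ (Real.exp_pos _).le]
    congr 1
    rw [← Real.exp_half]
    ring_nf
  have hgram := abs_norm_sq_toEuclideanLin_sub_le
    (multibandDictionary Bnyq Bband Ts J hkN s) (μ := 3 * Real.sqrt δ) ?_ ?_ (by positivity) α
  rotate_left
  · rintro ⟨i, l⟩
    simp only [multibandDictionary_apply]
    rw [sum_conj_modulate_mul_modulate]
    simp only [modulate, sub_self]
    have := hs.sum_sq (Fin.castLE hkN l)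
    have h2 : ∀ n : ℤ, fourierChar 0 n = 1 := by simp [fourierChar]
    simp only [h2, one_mul, Complex.conj_ofReal]
    rw [← Complex.ofReal_one, ← this]
    push_cast
    exact Finset.sum_congr rfl fun _ _ => by ring
  · rintro ⟨i, l⟩ ⟨i', l'⟩ hne
    simp only [multibandDictionary_apply]
    rw [sum_conj_modulate_mul_modulate]
    by_cases hi : i = i'
    · subst hi
      have hl : l ≠ l' := fun h => hne (by rw [h])
      have := hs.sum_mul (Fin.castLE hkN l) (Fin.castLE hkN l')
      rw [if_neg ((Fin.castLE_injective hkN).ne hl)] at this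
      have h2 : ∀ n : ℤ, fourierChar 0 n = 1 := by simp [fourierChar]
      simp only [modulate, sub_self, h2, one_mul, Complex.conj_ofReal]
      have h3 : ∑ n : Fin N, (s (Fin.castLE hkN l) ((n : ℕ) : ℤ) : ℂ) *
          (s (Fin.castLE hkN l') ((n : ℕ) : ℤ) : ℂ) = 0 := by exact_mod_cast this
      rw [h3, norm_zero]
      positivity
    · have hg : bandCenter Bnyq Bband i * Ts - bandCenter Bnyq Bband i' * Ts =
          ((i : ℝ) - (i' : ℝ)) * (2 * W) := by
        rw [hW]; unfold bandCenter; ring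
      have habs : |((i : ℝ) - (i' : ℝ)) * (2 * W)| = |((i : ℝ) - (i' : ℝ))| * (2 * W) := by
        rw [abs_mul, abs_of_pos (by positivity : 0 < 2 * W)]
      have hne' : (i : ℤ) ≠ (i' : ℤ) := fun h => hi (Fin.ext (by exact_mod_cast h))
      have hge : (1 : ℝ) ≤ |((i : ℝ) - (i' : ℝ))| := by
        have : (1 : ℤ) ≤ |(i : ℤ) - (i' : ℤ)| := Int.one_le_abs (sub_ne_zero.mpr hne')
        exact_mod_cast this
      -- With 2WJ ≤ 1 this keeps the bands apart also across the wrap-around of the period.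
      have hle : |((i : ℝ) - (i' : ℝ))| + 1 ≤ J := by
        have : |(i : ℤ) - (i' : ℤ)| + 1 ≤ J := by
          rcases abs_cases ((i : ℤ) - (i' : ℤ)) with h | h <;> omega
        exact_mod_cast this
      refine norm_sum_conj_modulate_mul_le hWpos.le hδ0
        (hs.isProlateEigenvector (Fin.castLE hkN l'))
        (hs.isProlateEigenvector (Fin.castLE hkN l)) (hs.sum_sq _) (hs.sum_sq _)
        (hlam _ (by simp)) (hs.lam_lt_one _).le
        (hlam _ (by simp)) ?_ ?_
      · rw [hg, habs]; nlinarith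
      · rw [hg, habs]; nlinarith
  have hαpos : 0 < ‖α‖ := norm_pos_iff.mpr hα
  have hcard : (Fintype.card (Fin J × Fin k) : ℝ) ≤ N := by
    have : J * k ≤ N := by rw [mul_comm]; exact hkJ.le
    simp only [Fintype.card_prod, Fintype.card_fin]
    exact_mod_cast this
  have hμ : 3 * Real.sqrt δ * Fintype.card (Fin J × Fin k) ≤
      3 * N * Real.sqrt C₁ * Real.exp (-(C₂ * N / 2)) := by
    calc 3 * Real.sqrt δ * Fintype.card (Fin J × Fin k) ≤ 3 * Real.sqrt δ * N := by gcongr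
      _ = _ := by rw [hsq]; ring
  set x := 3 * N * Real.sqrt C₁ * Real.exp (-(C₂ * N / 2))
  have hb : |‖Matrix.toEuclideanLin (multibandDictionary Bnyq Bband Ts J hkN s) α‖ ^ 2 -
      ‖α‖ ^ 2| ≤ x * ‖α‖ ^ 2 := hgram.trans (by gcongr)
  rw [abs_le] at hb
  have hα2 : 0 < ‖α‖ ^ 2 := by positivity
  constructor
  · apply Real.sqrt_le_iff.mpr
    refine ⟨by positivity, ?_⟩
    rw [div_pow, le_div_iff₀ hα2]
    linarith [hb.1]
  · apply Real.le_sqrt_of_sq_le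
    rw [div_pow, div_le_iff₀ hα2]
    linarith [hb.2]

/-! ### Expansion in DPSS vectors and the minimax bound. -/

theorem IsDPSS.sum_mul_dual {N : ℕ} {W : ℝ} {lam : Fin N → ℝ} {s : Fin N → ℤ → ℝ}
    (h : IsDPSS N W lam s) (m n : Fin N) :
    ∑ l, s l ((m : ℕ) : ℤ) * s l ((n : ℕ) : ℤ) = if m = n then 1 else 0 := by
  let S : Matrix (Fin N) (Fin N) ℝ := Matrix.of fun l n => s l ((n : ℕ) : ℤ)
  have h1 : S * S.transpose = 1 := by
    ext l l'
    rw [Matrix.mul_apply, Matrix.one_apply]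
    exact h.sum_mul l l'
  have h2 : (S.transpose * S) m n = (1 : Matrix (Fin N) (Fin N) ℝ) m n := by
    rw [mul_eq_one_comm.mp h1]
  rwa [Matrix.mul_apply, Matrix.one_apply] at h2

theorem IsDPSS.expansion {N : ℕ} {W : ℝ} {lam : Fin N → ℝ} {s : Fin N → ℤ → ℝ}
    (h : IsDPSS N W lam s) (v : Fin N → ℂ) (m : Fin N) :
    v m = ∑ l, (s l ((m : ℕ) : ℤ) : ℂ) * ∑ n : Fin N, (s l ((n : ℕ) : ℤ) : ℂ) * v n := by
  simp only [Finset.mul_sum, ← mul_assoc]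
  rw [Finset.sum_comm]
  simp only [← Finset.sum_mul]
  have : ∀ n : Fin N, ∑ l, (s l ((m : ℕ) : ℤ) : ℂ) * (s l ((n : ℕ) : ℤ) : ℂ) =
      if m = n then 1 else 0 := fun n => by
    have := h.sum_mul_dual m n
    split_ifs at this ⊢ <;> exact_mod_cast this
  simp [this]

theorem IsDPSS.sum_norm_sq {N : ℕ} {W : ℝ} {lam : Fin N → ℝ} {s : Fin N → ℤ → ℝ}
    (h : IsDPSS N W lam s) (v : Fin N → ℂ) :
    ∑ n, ‖v n‖ ^ 2 = ∑ l, ‖∑ n : Fin N, (s l ((n : ℕ) : ℤ) : ℂ) * v n‖ ^ 2 := by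
  have key : ((∑ n, ‖v n‖ ^ 2 : ℝ) : ℂ) =
      ((∑ l, ‖∑ n : Fin N, (s l ((n : ℕ) : ℤ) : ℂ) * v n‖ ^ 2 : ℝ) : ℂ) := by
    rw [Complex.ofReal_sum, Complex.ofReal_sum]
    simp only [← conj_mul_self_eq]
    calc ∑ m, conj (v m) * v m = ∑ m, ∑ l, conj (v m) * ((s l ((m : ℕ) : ℤ) : ℂ) *
          ∑ n : Fin N, (s l ((n : ℕ) : ℤ) : ℂ) * v n) := by
          refine Finset.sum_congr rfl fun m _ => ?_
          rw [← Finset.mul_sum, ← h.expansion v m]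
      _ = _ := by
          rw [Finset.sum_comm]
          refine Finset.sum_congr rfl fun l _ => ?_
          rw [map_sum, Finset.sum_mul]
          refine Finset.sum_congr rfl fun m _ => ?_
          rw [map_mul, Complex.conj_ofReal]
          ring
  exact_mod_cast key

theorem IsDPSS.integral_norm_sq {N : ℕ} {W : ℝ} {lam : Fin N → ℝ} {s : Fin N → ℤ → ℝ}
    (h : IsDPSS N W lam s) (v : Fin N → ℂ) :
    ∫ f in (-W)..W, ‖freqResponse v f‖ ^ 2 =
      ∑ l, lam l * ‖∑ n : Fin N, (s l ((n : ℕ) : ℤ) : ℂ) * v n‖ ^ 2 := by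
  have hV : ∀ f, freqResponse v f = ∑ l, (∑ n : Fin N, (s l ((n : ℕ) : ℤ) : ℂ) * v n) *
      freqResponse (fun n : Fin N => (s l ((n : ℕ) : ℤ) : ℂ)) f := by
    intro f
    unfold freqResponse
    simp only [Finset.mul_sum]
    rw [Finset.sum_comm]
    refine Finset.sum_congr rfl fun m _ => ?_
    rw [h.expansion v m, Finset.sum_mul]
    refine Finset.sum_congr rfl fun l _ => ?_
    ring
  have key : ((∫ f in (-W)..W, ‖freqResponse v f‖ ^ 2 : ℝ) : ℂ) =
      ((∑ l, lam l * ‖∑ n : Fin N, (s l ((n : ℕ) : ℤ) : ℂ) * v n‖ ^ 2 : ℝ) : ℂ) := by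
    rw [← intervalIntegral.integral_ofReal]
    simp only [← conj_mul_self_eq]
    calc ∫ f in (-W)..W, conj (freqResponse v f) * freqResponse v f =
        ∫ f in (-W)..W, ∑ l, (∑ n : Fin N, (s l ((n : ℕ) : ℤ) : ℂ) * v n) *
          (conj (freqResponse v f) *
            freqResponse (fun n : Fin N => (s l ((n : ℕ) : ℤ) : ℂ)) f) := by
          refine intervalIntegral.integral_congr fun f _ => ?_
          conv_lhs => arg 2; rw [hV f]
          rw [Finset.mul_sum]
          exact Finset.sum_congr rfl fun l _ => by ring
      _ = ∑ l, (∑ n : Fin N, (s l ((n : ℕ) : ℤ) : ℂ) * v n) *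
          (lam l * ∑ n : Fin N, conj (v n) * (s l ((n : ℕ) : ℤ) : ℂ)) := by
          rw [intervalIntegral.integral_finsetSum]
          · refine Finset.sum_congr rfl fun l _ => ?_
            rw [intervalIntegral.integral_const_mul,
              (h.isProlateEigenvector l).integral_conj_mul]
          · exact fun l _ => Continuous.intervalIntegrable (by fun_prop) _ _
      _ = _ := by
          rw [Complex.ofReal_sum]
          refine Finset.sum_congr rfl fun l _ => ?_
          rw [Complex.ofReal_mul, ← conj_mul_self_eq, map_sum]
          simp only [map_mul, Complex.conj_ofReal]
          have : ∑ n : Fin N, conj (v n) * (s l ((n : ℕ) : ℤ) : ℂ) =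
              ∑ n : Fin N, (s l ((n : ℕ) : ℤ) : ℂ) * conj (v n) :=
            Finset.sum_congr rfl fun _ _ => mul_comm _ _
          rw [this]
          ring
  exact_mod_cast key

/-- The energy outside `[-W, W]` of a vector orthogonal to the first `l` DPSS vectors. -/
theorem IsDPSS.le_integral_norm_sq_outside {N : ℕ} {W : ℝ} {lam : Fin N → ℝ}
    {s : Fin N → ℤ → ℝ} (h : IsDPSS N W lam s) (l : Fin N) (v : Fin N → ℂ)
    (hv : ∀ i < l, ∑ n : Fin N, (s i ((n : ℕ) : ℤ) : ℂ) * v n = 0) :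
    (1 - lam l) * ∑ n, ‖v n‖ ^ 2 ≤ ∫ f in W..(1 - W), ‖freqResponse v f‖ ^ 2 := by
  have I := intervalIntegrable_norm_sq_freqResponse v
  have h1 := integral_norm_sq_freqResponse_period (-W) v
  have e : -W + 1 = 1 - W := by ring
  rw [e, ← intervalIntegral.integral_add_adjacent_intervals (I (-W) W) (I W (1 - W))] at h1
  have h2 : ∫ f in (-W)..W, ‖freqResponse v f‖ ^ 2 ≤ lam l * ∑ n, ‖v n‖ ^ 2 := by
    rw [h.integral_norm_sq, h.sum_norm_sq, Finset.mul_sum]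
    refine Finset.sum_le_sum fun i _ => ?_
    rcases lt_or_ge i l with hi | hi
    · simp [hv i hi]
    · have := h.lam_strictAnti.antitone hi
      gcongr
  linarith

/-- Minimax bound: a `K`-parameter family of vectors whose energy outside the band is at most the
fraction `η` forces the first `K` eigenvalues to be at least `1 - η`. -/
theorem IsDPSS.one_sub_le_of_linearMap {N K : ℕ} {W η : ℝ} {lam : Fin N → ℝ}
    {s : Fin N → ℤ → ℝ} (h : IsDPSS N W lam s) (L : (Fin K → ℂ) →ₗ[ℂ] (Fin N → ℂ))
    (hpos : ∀ c, c ≠ 0 → 0 < ∑ n, ‖L c n‖ ^ 2)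
    (hL : ∀ c, ∫ f in W..(1 - W), ‖freqResponse (L c) f‖ ^ 2 ≤ η * ∑ n, ‖L c n‖ ^ 2)
    (l : Fin N) (hl : (l : ℕ) < K) : 1 - η ≤ lam l := by
  let A : (Fin N → ℂ) →ₗ[ℂ] (Fin l → ℂ) :=
    Matrix.mulVecLin (Matrix.of fun (i : Fin l) (n : Fin N) =>
      (s (Fin.castLE l.2.le i) ((n : ℕ) : ℤ) : ℂ))
  -- Fewer than `K` linear conditions on `K` parameters: some nonzero `c` makes `L c` orthogonal to
  -- the first `l` DPSS vectors.
  have hker : LinearMap.ker (A ∘ₗ L) ≠ ⊥ := by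
    apply LinearMap.ker_ne_bot_of_finrank_lt
    simpa using hl
  obtain ⟨c, hc, hc0⟩ := Submodule.exists_mem_ne_zero_of_ne_bot hker
  have horth : ∀ i < l, ∑ n : Fin N, (s i ((n : ℕ) : ℤ) : ℂ) * L c n = 0 := by
    intro i hi
    have := congrFun (LinearMap.mem_ker.mp hc) ⟨i, hi⟩
    simpa [A, Matrix.mulVec, dotProduct] using this
  have h1 := h.le_integral_norm_sq_outside l (L c) horth
  have h2 := hL c
  have h3 := hpos c hc0
  have := le_of_mul_le_mul_right (h1.trans h2) h3
  linarith

/-! ### Smoothed windows and exponential clustering of the eigenvalues. -/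

/-- A box of length `Q` smoothed by a binomial kernel of order `r`. -/
def smoothWindow (Q r : ℕ) (n : ℕ) : ℝ :=
  ∑ k ∈ Finset.range (r + 1), (r.choose k : ℝ) / 2 ^ r * if k ≤ n ∧ n < k + Q then 1 else 0

theorem smoothWindow_eq_one {Q r n : ℕ} (h1 : r ≤ n) (h2 : n < Q) : smoothWindow Q r n = 1 := by
  unfold smoothWindow
  have : ∀ k ∈ Finset.range (r + 1),
      (r.choose k : ℝ) / 2 ^ r * (if k ≤ n ∧ n < k + Q then 1 else 0) = r.choose k / 2 ^ r := by
    intro k hk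
    rw [Finset.mem_range] at hk
    rw [if_pos ⟨by omega, by omega⟩, mul_one]
  rw [Finset.sum_congr rfl this, ← Finset.sum_div]
  have h := Nat.sum_range_choose r
  have h' : ∑ k ∈ Finset.range (r + 1), (r.choose k : ℝ) = 2 ^ r := by exact_mod_cast h
  rw [h', div_self (by positivity)]

theorem fourierChar_nat (f : ℝ) (n : ℕ) : fourierChar f (-(n : ℤ)) = fourierChar f (-1) ^ n := by
  unfold fourierChar
  rw [← Complex.exp_nat_mul]
  push_cast
  ring_nf

/-- The window is the convolution of a box with binomial weights, so its transform is the product of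
theirs. -/
theorem sum_smoothWindow_mul (Q r : ℕ) (f : ℝ) :
    ∑ n ∈ Finset.range (Q + r), (smoothWindow Q r n : ℂ) * fourierChar f (-(n : ℤ)) =
      ((fourierChar f (-1) + 1) / 2) ^ r *
        ∑ j ∈ Finset.range Q, fourierChar f (-(j : ℤ)) := by
  simp only [smoothWindow, Complex.ofReal_sum, Finset.sum_mul]
  rw [Finset.sum_comm, div_pow, add_pow, Finset.sum_div, Finset.sum_mul]
  refine Finset.sum_congr rfl fun k hk => ?_
  rw [Finset.mem_range] at hk
  have h1 : ∀ n ∈ Finset.range (Q + r), n ∉ Finset.Ico k (k + Q) →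
      (((r.choose k : ℝ) / 2 ^ r * (if k ≤ n ∧ n < k + Q then 1 else 0) : ℝ) : ℂ) *
        fourierChar f (-(n : ℤ)) = 0 := by
    intro n _ hn
    rw [Finset.mem_Ico] at hn
    simp [hn]
  rw [← Finset.sum_subset (s₁ := Finset.Ico k (k + Q)) _ h1, Finset.sum_Ico_eq_sum_range,
    Nat.add_sub_cancel_left, Finset.mul_sum]
  · refine Finset.sum_congr rfl fun j hj => ?_
    rw [Finset.mem_range] at hj
    rw [if_pos ⟨by omega, by omega⟩]
    push_cast
    rw [neg_add, fourierChar_add, fourierChar_nat f k]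
    ring
  · intro n hn
    rw [Finset.mem_Ico] at hn
    rw [Finset.mem_range]
    omega

theorem norm_fourierChar_add_one_sq (f : ℝ) :
    ‖(fourierChar f (-1) + 1) / 2‖ ^ 2 = (1 + Real.cos (2 * Real.pi * f)) / 2 := by
  rw [norm_div, div_pow, ← Complex.normSq_eq_norm_sq, fourierChar_eq, Complex.exp_mul_I,
    ← Complex.ofReal_cos, ← Complex.ofReal_sin, Complex.normSq_apply]
  simp only [Complex.add_re, Complex.add_im, Complex.ofReal_re, Complex.ofReal_im, Complex.one_re,
    Complex.one_im, Complex.mul_re, Complex.mul_im, Complex.I_re, Complex.I_im, Complex.norm_ofNat]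
  push_cast
  have := Real.sin_sq_add_cos_sq (2 * Real.pi * f * -1)
  have h2 : Real.cos (2 * Real.pi * f * -1) = Real.cos (2 * Real.pi * f) := by
    rw [mul_neg_one, Real.cos_neg]
  rw [← h2]
  nlinarith

theorem cos_two_pi_mul_le {f δ : ℝ} (hδ : 0 ≤ δ) (h1 : δ ≤ f) (h2 : f ≤ 1 - δ) :
    Real.cos (2 * Real.pi * f) ≤ Real.cos (2 * Real.pi * δ) := by
  have hpi := Real.pi_pos
  rcases le_total f (1 / 2) with h | h
  · apply Real.cos_le_cos_of_nonneg_of_le_pi <;> nlinarith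
  · have : Real.cos (2 * Real.pi * f) = Real.cos (2 * Real.pi * (1 - f)) := by
      rw [show 2 * Real.pi * (1 - f) = 2 * Real.pi - 2 * Real.pi * f by ring,
        Real.cos_two_pi_sub]
    rw [this]
    apply Real.cos_le_cos_of_nonneg_of_le_pi <;> nlinarith

/-- The box factor is bounded trivially by `Q`; all the decay comes from the binomial factor, whose
squared modulus is (1 + cos 2πf)/2 to the power `r`. -/
theorem norm_sq_sum_smoothWindow_le (Q r : ℕ) {f δ : ℝ} (hδ : 0 ≤ δ) (h1 : δ ≤ f)
    (h2 : f ≤ 1 - δ) :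
    ‖∑ n ∈ Finset.range (Q + r), (smoothWindow Q r n : ℂ) * fourierChar f (-(n : ℤ))‖ ^ 2 ≤
      Q ^ 2 * ((1 + Real.cos (2 * Real.pi * δ)) / 2) ^ r := by
  have hs : ‖∑ j ∈ Finset.range Q, fourierChar f (-(j : ℤ))‖ ≤ Q := by
    refine (norm_sum_le _ _).trans ?_
    simp
  have hc : (1 + Real.cos (2 * Real.pi * f)) / 2 ≤ (1 + Real.cos (2 * Real.pi * δ)) / 2 := by
    linarith [cos_two_pi_mul_le hδ h1 h2]
  have h0 : 0 ≤ (1 + Real.cos (2 * Real.pi * f)) / 2 := by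
    linarith [Real.neg_one_le_cos (2 * Real.pi * f)]
  rw [sum_smoothWindow_mul, norm_mul, norm_pow, mul_pow, ← pow_mul, mul_comm r 2, pow_mul,
    norm_fourierChar_add_one_sq, mul_comm]
  gcongr

/-- A geometric sum over a full period of an M-th root of unity, which differs from 1 because 0 <
|d| < M. -/
theorem sum_fourierChar_div {M : ℕ} (d : ℤ) (hd : d ≠ 0) (hdM : |d| < M) (a : ℤ) :
    ∑ n ∈ Finset.range M, fourierChar (d / M) (a + n) = 0 := by
  have hM : 0 < (M : ℤ) := lt_of_le_of_lt (abs_nonneg d) hdM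
  have hM' : (M : ℂ) ≠ 0 := by
    have : M ≠ 0 := by omega
    exact_mod_cast this
  set z := fourierChar ((d : ℝ) / M) 1 with hz
  have hpow : ∀ n : ℕ, fourierChar ((d : ℝ) / M) n = z ^ n := by
    intro n
    rw [hz]; unfold fourierChar
    rw [← Complex.exp_nat_mul]
    push_cast
    ring_nf
  have hzM : z ^ M = 1 := by
    rw [← hpow]; unfold fourierChar
    rw [Complex.exp_eq_one_iff]
    exact ⟨d, by push_cast; field_simp⟩
  have hz1 : z ≠ 1 := by
    intro h
    rw [hz] at h; unfold fourierChar at h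
    rw [Complex.exp_eq_one_iff] at h
    obtain ⟨k, hk⟩ := h
    have h2 : (2 * Real.pi * Complex.I : ℂ) ≠ 0 := Complex.two_pi_I_ne_zero
    have h3 : (d : ℂ) = k * M := by
      have : (2 * Real.pi * Complex.I : ℂ) * d = (2 * Real.pi * Complex.I) * (k * M) := by
        push_cast at hk
        field_simp at hk
        linear_combination (2 * Real.pi * Complex.I : ℂ) * hk
      exact mul_left_cancel₀ h2 this
    have h4 : d = k * M := by exact_mod_cast h3
    exact hd (Int.eq_zero_of_abs_lt_dvd ⟨k, by rw [h4]; ring⟩ hdM)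
  simp only [fourierChar_add, hpow]
  rw [← Finset.mul_sum, geom_sum_eq hz1, hzM, sub_self, zero_div, mul_zero]

/-- The frequencies `j/M`, `|j| ≤ K₀`, on the grid with spacing `1/M`. -/
def gridFreq (M K₀ : ℕ) (j : Fin (2 * K₀ + 1)) : ℝ := (((j : ℕ) : ℤ) - K₀ : ℤ) / M

/-- The discrete Fourier transform is an isometry up to scaling. -/
theorem sum_norm_sq_gridFreq {M K₀ : ℕ} (hK : 2 * K₀ + 1 ≤ M) (c : Fin (2 * K₀ + 1) → ℂ)
    (a : ℤ) :
    ∑ n ∈ Finset.range M, ‖∑ j, c j * fourierChar (gridFreq M K₀ j) (a + n)‖ ^ 2 =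
      M * ∑ j, ‖c j‖ ^ 2 := by
  have key : ((∑ n ∈ Finset.range M,
      ‖∑ j, c j * fourierChar (gridFreq M K₀ j) (a + n)‖ ^ 2 : ℝ) : ℂ) =
      ((M * ∑ j, ‖c j‖ ^ 2 : ℝ) : ℂ) := by
    rw [Complex.ofReal_sum, Complex.ofReal_mul, Complex.ofReal_sum]
    simp only [← conj_mul_self_eq, map_sum, Finset.sum_mul_sum, map_mul]
    rw [Finset.sum_comm, Finset.mul_sum]
    refine Finset.sum_congr rfl fun i _ => ?_
    rw [Finset.sum_comm, Finset.sum_eq_single i]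
    · have : ∀ n : ℕ, conj (c i) * conj (fourierChar (gridFreq M K₀ i) (a + n)) *
          (c i * fourierChar (gridFreq M K₀ i) (a + n)) = conj (c i) * c i := by
        intro n
        rw [conj_fourierChar]
        linear_combination (conj (c i) * c i) * fourierChar_mul_neg (gridFreq M K₀ i) (a + n)
      simp [this]
    · intro j _ hji
      have hd : ((j : ℕ) : ℤ) - ((i : ℕ) : ℤ) ≠ 0 := fun h => hji (Fin.ext (by omega))
      have hdM : |((j : ℕ) : ℤ) - ((i : ℕ) : ℤ)| < M := by
        rcases abs_cases (((j : ℕ) : ℤ) - ((i : ℕ) : ℤ)) with h | h <;> omega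
      have hsum := sum_fourierChar_div _ hd hdM a
      have : ∀ n : ℕ, conj (c i) * conj (fourierChar (gridFreq M K₀ i) (a + n)) *
          (c j * fourierChar (gridFreq M K₀ j) (a + n)) = conj (c i) * c j *
          fourierChar ((((j : ℕ) : ℤ) - ((i : ℕ) : ℤ) : ℤ) / M) (a + n) := by
        intro n
        have e : ((((j : ℕ) : ℤ) - ((i : ℕ) : ℤ) : ℤ) : ℝ) / M =
            gridFreq M K₀ j + -gridFreq M K₀ i := by
          unfold gridFreq; push_cast; ring
        rw [conj_fourierChar, e, fourierChar_add_left, fourierChar_neg_left]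
        ring
      simp only [this]
      rw [← Finset.mul_sum, hsum, mul_zero]
    · simp
  exact_mod_cast key

/-- Smoothly windowed trigonometric sums with frequencies on the grid. -/
def windowedSum (N Q r M K₀ : ℕ) : (Fin (2 * K₀ + 1) → ℂ) →ₗ[ℂ] (Fin N → ℂ) :=
  Matrix.mulVecLin (Matrix.of fun (n : Fin N) (j : Fin (2 * K₀ + 1)) =>
    (smoothWindow Q r n : ℂ) * fourierChar (gridFreq M K₀ j) ((n : ℕ) : ℤ))

theorem windowedSum_apply (N Q r M K₀ : ℕ) (c : Fin (2 * K₀ + 1) → ℂ) (n : Fin N) :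
    windowedSum N Q r M K₀ c n = (smoothWindow Q r n : ℂ) *
      ∑ j, c j * fourierChar (gridFreq M K₀ j) ((n : ℕ) : ℤ) := by
  simp only [windowedSum, Matrix.mulVecLin_apply, Matrix.mulVec, dotProduct, Matrix.of_apply,
    Finset.mul_sum]
  exact Finset.sum_congr rfl fun j _ => by ring

/-- The window equals 1 on the `M` consecutive indices r, …, r+M-1, where discrete Parseval is
exact; the remaining indices only add energy. -/
theorem le_sum_norm_sq_windowedSum {r M K₀ : ℕ} (hK : 2 * K₀ + 1 ≤ M)
    (c : Fin (2 * K₀ + 1) → ℂ) :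
    M * ∑ j, ‖c j‖ ^ 2 ≤ ∑ n, ‖windowedSum (r + M + r) (r + M) r M K₀ c n‖ ^ 2 := by
  simp only [windowedSum_apply]
  rw [← sum_norm_sq_gridFreq hK c r, ← Finset.sum_range fun n => ‖(smoothWindow (r + M) r n : ℂ) *
      ∑ j, c j * fourierChar (gridFreq M K₀ j) (n : ℤ)‖ ^ 2]
  calc _ = ∑ n ∈ Finset.Ico r (r + M), ‖(smoothWindow (r + M) r n : ℂ) *
      ∑ j, c j * fourierChar (gridFreq M K₀ j) (n : ℤ)‖ ^ 2 := by
        rw [Finset.sum_Ico_eq_sum_range, Nat.add_sub_cancel_left]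
        refine Finset.sum_congr rfl fun n hn => ?_
        rw [Finset.mem_range] at hn
        rw [smoothWindow_eq_one (by omega) (by omega)]
        simp
    _ ≤ _ := by
        refine Finset.sum_le_sum_of_subset_of_nonneg ?_ fun _ _ _ => by positivity
        intro n hn
        rw [Finset.mem_Ico] at hn
        rw [Finset.mem_range]
        omega

theorem freqResponse_windowedSum (Q r M K₀ : ℕ) (c : Fin (2 * K₀ + 1) → ℂ) (f : ℝ) :
    freqResponse (windowedSum (Q + r) Q r M K₀ c) f = ∑ j, c j *
      ∑ n ∈ Finset.range (Q + r), (smoothWindow Q r n : ℂ) *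
        fourierChar (f - gridFreq M K₀ j) (-(n : ℤ)) := by
  unfold freqResponse
  simp only [windowedSum_apply]
  rw [← Finset.sum_range fun n => (smoothWindow Q r n : ℂ) *
      (∑ j, c j * fourierChar (gridFreq M K₀ j) (n : ℤ)) * fourierChar f (-(n : ℤ))]
  simp only [Finset.mul_sum, Finset.sum_mul]
  rw [Finset.sum_comm]
  refine Finset.sum_congr rfl fun j _ => Finset.sum_congr rfl fun n _ => ?_
  rw [sub_eq_add_neg, fourierChar_add_left, fourierChar_neg_left, neg_neg]
  ring

theorem abs_gridFreq_le {M K₀ : ℕ} (j : Fin (2 * K₀ + 1)) : |gridFreq M K₀ j| ≤ K₀ / M := by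
  unfold gridFreq
  rw [abs_div, Nat.abs_cast]
  gcongr
  have : |((j : ℕ) : ℤ) - (K₀ : ℤ)| ≤ K₀ := by
    rw [abs_le]; omega
  exact_mod_cast this

/-- The DPSS eigenvalues below the time-bandwidth product are exponentially close to one. -/
theorem IsDPSS.one_sub_lam_le {N r M K₀ : ℕ} {W δ : ℝ} {lam : Fin N → ℝ}
    {s : Fin N → ℤ → ℝ} (h : IsDPSS N W lam s) (hN : N = r + M + r) (hK : 2 * K₀ + 1 ≤ M)
    (hW0 : 0 ≤ W) (hW : W ≤ 1 / 2) (hδ : 0 ≤ δ) (hKM : (K₀ : ℝ) / M ≤ W - δ) (l : Fin N)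
    (hl : (l : ℕ) ≤ 2 * K₀) :
    1 - N ^ 2 * ((1 + Real.cos (2 * Real.pi * δ)) / 2) ^ r ≤ lam l := by
  set q := (1 + Real.cos (2 * Real.pi * δ)) / 2 with hq
  have hq0 : 0 ≤ q := by linarith [Real.neg_one_le_cos (2 * Real.pi * δ)]
  have hM : 0 < (M : ℝ) := by
    have : 0 < M := by omega
    exact_mod_cast this
  subst hN
  refine h.one_sub_le_of_linearMap (windowedSum (r + M + r) (r + M) r M K₀) ?_ ?_ l (by omega)
  · intro c hc
    refine lt_of_lt_of_le ?_ (le_sum_norm_sq_windowedSum hK c)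
    obtain ⟨j, hj⟩ := Function.ne_iff.mp hc
    have : 0 < ∑ j, ‖c j‖ ^ 2 :=
      Finset.sum_pos' (fun _ _ => by positivity)
        ⟨j, Finset.mem_univ _, by have := norm_pos_iff.mpr hj; positivity⟩
    positivity
  · intro c
    set B : ℝ := ((r + M : ℕ) : ℝ) ^ 2 * q ^ r with hB
    have hB0 : 0 ≤ B := by positivity
    have hpt : ∀ f ∈ Set.Icc W (1 - W),
        ‖freqResponse (windowedSum (r + M + r) (r + M) r M K₀ c) f‖ ^ 2 ≤
          M * B * ∑ j, ‖c j‖ ^ 2 := by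
      rintro f ⟨hf1, hf2⟩
      rw [freqResponse_windowedSum]
      have hG : ∀ j, ‖∑ n ∈ Finset.range (r + M + r), (smoothWindow (r + M) r n : ℂ) *
          fourierChar (f - gridFreq M K₀ j) (-(n : ℤ))‖ ≤ Real.sqrt B := by
        intro j
        have hj := abs_le.mp (abs_gridFreq_le (M := M) j)
        apply Real.le_sqrt_of_sq_le
        -- Since W ≤ f ≤ 1 - W and grid frequencies are at most W - δ in modulus, the shifted
        -- frequency lies in [δ, 1 - δ].
        exact norm_sq_sum_smoothWindow_le _ _ hδ (by linarith [hj.2]) (by linarith [hj.1])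
      calc _ ≤ (∑ j, ‖c j‖ * Real.sqrt B) ^ 2 := by
            gcongr
            refine (norm_sum_le _ _).trans (Finset.sum_le_sum fun j _ => ?_)
            rw [norm_mul]
            gcongr
            exact hG j
        _ = B * (∑ j, ‖c j‖) ^ 2 := by
            rw [← Finset.sum_mul, mul_pow, Real.sq_sqrt hB0, mul_comm]
        _ ≤ B * ((2 * K₀ + 1 : ℕ) * ∑ j, ‖c j‖ ^ 2) := by
            gcongr
            have := sq_sum_le_card_mul_sum_sq (s := Finset.univ) (f := fun j => ‖c j‖)
            simpa using this
        _ ≤ B * (M * ∑ j, ‖c j‖ ^ 2) := by gcongr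
        _ = _ := by ring
    calc _ ≤ ∫ _ in W..(1 - W), M * B * ∑ j, ‖c j‖ ^ 2 :=
          intervalIntegral.integral_mono_on (by linarith)
            (intervalIntegrable_norm_sq_freqResponse _ _ _) (by simp) hpt
      _ = (1 - 2 * W) * (B * (M * ∑ j, ‖c j‖ ^ 2)) := by
          rw [intervalIntegral.integral_const, smul_eq_mul]; ring
      _ ≤ 1 * (B * (M * ∑ j, ‖c j‖ ^ 2)) := by
          gcongr; linarith
      _ ≤ _ := by
          rw [one_mul]
          have h1 := le_sum_norm_sq_windowedSum (r := r) hK c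
          have h2 : B ≤ ((r + M + r : ℕ) : ℝ) ^ 2 * q ^ r := by
            
            have : r + M ≤ r + M + r := Nat.le_add_right _ _
            exact mul_le_mul_of_nonneg_right
              (pow_le_pow_left₀ (by positivity) (by exact_mod_cast this) 2) (by positivity)
          exact mul_le_mul h2 h1 (by positivity) (by positivity)

/-- With C = -(a/2) log q, q^(r+1) ≤ e^{-2CN}. Half of this decay absorbs the factor N² and the
power of `q` lost to rounding, so the constant in front is 1. -/
theorem sq_mul_pow_le_exp {N r : ℕ} {a q : ℝ} (hq0 : 0 < q) (hq1 : q < 1) (hr : a * N ≤ r + 1)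
    (hN : (N : ℝ) ^ 2 * Real.exp (-(-(a / 2 * Real.log q))) ^ N ≤ q) :
    (N : ℝ) ^ 2 * q ^ r ≤ Real.exp (-(-(a / 2 * Real.log q) * N)) := by
  have hlog : Real.log q < 0 := Real.log_neg hq0 hq1
  set C := -(a / 2 * Real.log q) with hC
  have e1 : q ^ (r + 1) ≤ Real.exp (-C) ^ N * Real.exp (-(C * N)) := by
    rw [← Real.exp_nat_mul, ← Real.exp_add]
    have h1 : q ^ (r + 1) = Real.exp ((r + 1 : ℕ) * Real.log q) := by
      rw [Real.exp_nat_mul, Real.exp_log hq0]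
    have h2 : (r + 1 : ℝ) * Real.log q ≤ a * N * Real.log q :=
      mul_le_mul_of_nonpos_right hr hlog.le
    rw [h1, Real.exp_le_exp, hC]
    push_cast
    linarith
  have e2 : q * ((N : ℝ) ^ 2 * q ^ r) ≤ q * Real.exp (-(C * N)) := by
    calc q * ((N : ℝ) ^ 2 * q ^ r) = (N : ℝ) ^ 2 * q ^ (r + 1) := by ring
      _ ≤ (N : ℝ) ^ 2 * (Real.exp (-C) ^ N * Real.exp (-(C * N))) := by gcongr
      _ = ((N : ℝ) ^ 2 * Real.exp (-C) ^ N) * Real.exp (-(C * N)) := by ring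
      _ ≤ q * Real.exp (-(C * N)) := by gcongr
  exact le_of_mul_le_mul_left e2 hq0

theorem exists_clusterNearOne {W ε : ℝ} (hW0 : 0 < W) (hW1 : W < 1 / 2) (hε0 : 0 < ε)
    (hε1 : ε < 1) : ∃ C₂ : ℝ, 0 < C₂ ∧ ∃ N₀ : ℕ, ClusterNearOne W ε 1 C₂ N₀ := by
  -- This margin and the window margin r ≈ εN/8 each cost a factor 1 - ε/4, so about 2NW(1 - ε/2)
  -- frequencies remain: more than needed, with slack for rounding.
  set δ := W * ε / 4 with hδ
  have hδ0 : 0 < δ := by positivity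
  have hδ1 : δ < 1 / 8 := by rw [hδ]; nlinarith
  set q := (1 + Real.cos (2 * Real.pi * δ)) / 2 with hq
  have hpi := Real.pi_pos
  have hcos1 : Real.cos (2 * Real.pi * δ) < 1 := by
    rw [← Real.cos_zero]
    apply Real.cos_lt_cos_of_nonneg_of_le_pi <;> nlinarith
  have hcos0 : 0 < Real.cos (2 * Real.pi * δ) :=
    Real.cos_pos_of_mem_Ioo ⟨by nlinarith, by nlinarith⟩
  have hq0 : 0 < q := by rw [hq]; linarith
  have hq1 : q < 1 := by rw [hq]; linarith
  have hlog : Real.log q < 0 := Real.log_neg hq0 hq1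
  set C := -(ε / 8 / 2 * Real.log q) with hC
  have hC0 : 0 < C := by
    have : 0 < ε / 8 / 2 * -Real.log q := by
      apply mul_pos (by positivity); linarith
    rw [hC]; linarith
  have hlim := tendsto_pow_const_mul_const_pow_of_abs_lt_one 2 (r := Real.exp (-C))
    (by rw [abs_of_pos (Real.exp_pos _)]; rw [Real.exp_lt_one_iff]; linarith)
  have hev1 : ∀ᶠ n : ℕ in Filter.atTop, (n : ℝ) ^ 2 * Real.exp (-C) ^ n ≤ q :=
    (hlim.eventually_lt_const hq0).mono fun _ h => h.le
  -- NWε ≥ 2 pays for the floor in `K₀`; N(1 - 2W) ≥ 2, below, ensures that the 2K₀ + 1 grid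
  -- frequencies fit into one period.
  have hev2 : ∀ᶠ n : ℕ in Filter.atTop, 2 / (W * ε) ≤ (n : ℝ) :=
    tendsto_natCast_atTop_atTop.eventually_ge_atTop _
  have hev3 : ∀ᶠ n : ℕ in Filter.atTop, 2 / (1 - 2 * W) ≤ (n : ℝ) :=
    tendsto_natCast_atTop_atTop.eventually_ge_atTop _
  obtain ⟨N₀, hN₀⟩ := Filter.eventually_atTop.mp (hev1.and (hev2.and hev3))
  refine ⟨C, hC0, N₀, fun N hN lam s h l hl => ?_⟩
  obtain ⟨hn1, hn2, hn3⟩ := hN₀ N hN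
  rw [div_le_iff₀ (by positivity)] at hn2
  rw [div_le_iff₀ (by linarith)] at hn3
  set r := ⌊ε / 8 * N⌋₊ with hr
  have hrle : (r : ℝ) ≤ ε / 8 * N := Nat.floor_le (by positivity)
  have hrgt : ε / 8 * N < r + 1 := Nat.lt_floor_add_one _
  have hNnn : (0 : ℝ) ≤ N := Nat.cast_nonneg N
  have h2r : 2 * r ≤ N := by
    have : (2 * r : ℝ) ≤ N := by nlinarith
    exact_mod_cast this
  obtain ⟨M, hM⟩ := Nat.exists_eq_add_of_le h2r
  have hNM : N = r + M + r := by omega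
  have hMge : (N : ℝ) * (1 - ε / 4) ≤ M := by
    have : (N : ℝ) = r + M + r := by exact_mod_cast hNM
    nlinarith
  have hWδ : W - δ = W * (1 - ε / 4) := by rw [hδ]; ring
  have hWδ0 : 0 < W - δ := by rw [hWδ]; apply mul_pos hW0; linarith
  set K₀ := ⌊M * (W - δ)⌋₊ with hK₀
  have hKle : (K₀ : ℝ) ≤ M * (W - δ) := Nat.floor_le (by positivity)
  have hKgt : M * (W - δ) < K₀ + 1 := Nat.lt_floor_add_one _
  have hN34 : (N : ℝ) * (3 / 4) ≤ M := by nlinarith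
  have hK : 2 * K₀ + 1 ≤ M := by
    have : (2 * K₀ + 1 : ℝ) ≤ M := by
      have h1 : (M : ℝ) * (W - δ) ≤ M * W := by gcongr; linarith
      have h2 : (N : ℝ) * (3 / 4) * (1 - 2 * W) ≤ M * (1 - 2 * W) := by
        apply mul_le_mul_of_nonneg_right hN34; linarith
      nlinarith
    exact_mod_cast this
  have hMpos : (0 : ℝ) < M := by
    have : 0 < M := by omega
    exact_mod_cast this
  have hlK : (l : ℕ) ≤ 2 * K₀ := by
    have h1 : (N : ℝ) * (1 - ε / 4) * (W * (1 - ε / 4)) ≤ M * (W - δ) := by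
      rw [hWδ]
      apply mul_le_mul_of_nonneg_right hMge; rw [← hWδ]; exact hWδ0.le
    have h2 : (0 : ℝ) ≤ N * W * ε ^ 2 := by positivity
    have : ((l : ℕ) : ℝ) ≤ 2 * K₀ := by nlinarith
    exact_mod_cast this
  have hmain := h.one_sub_lam_le hNM hK hW0.le hW1.le hδ0.le
    (by rw [div_le_iff₀ hMpos, mul_comm]; exact hKle) l hlK
  have hbound := sq_mul_pow_le_exp (N := N) (r := r) (a := ε / 8) hq0 hq1 hrgt.le hn1
  linarith

/-! ### Nonvanishing at a singular point of the prolate differential equation. -/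

open Polynomial in
/-- A nonzero polynomial solution of the prolate differential equation does not vanish at the
singular point `a`. -/
theorem eval_ne_zero_of_recurrence {P : ℂ[X]} {ν κ τ a : ℂ} (hP : P ≠ 0)
    (h0 : 2 * (κ * ((ν - 1) / 2) ^ 2 - τ) * P.coeff 0 + (ν - 1) * P.coeff 1 = 0)
    (hrec : ∀ n : ℕ, (n + 1) * (ν - n - 1) * P.coeff n +
      2 * (κ * (n + 1 - (ν - 1) / 2) ^ 2 - τ) * P.coeff (n + 1) +
      (n + 2) * (ν - n - 2) * P.coeff (n + 2) = 0)
    (ha : a ^ 2 + 1 = 2 * κ * a) (ha1 : a ^ 2 ≠ 1) : P.eval a ≠ 0 := by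
  have ha0 : a ≠ 0 := by
    rintro rfl
    simp at ha
  have hcoeff : ∀ (R : ℂ[X]) (k : ℕ), (X * derivative R).coeff k = k * R.coeff k := by
    intro R k
    cases k with
    | zero => simp
    | succ k => rw [coeff_X_mul, coeff_derivative]; push_cast; ring
  set Q₁ := X * derivative P with hQ₁
  set Q₂ := X * derivative Q₁ with hQ₂
  have hq1 : ∀ k : ℕ, Q₁.coeff k = k * P.coeff k := hcoeff P
  have hq2 : ∀ k : ℕ, Q₂.coeff k = k * (k * P.coeff k) := fun k => by
    rw [hQ₂, hcoeff, hq1]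
  -- The recurrence as a differential equation in the Euler operator x d/dx. The coefficient of `Q₂`
  -- is -(X² - 2κX + 1), which vanishes at `a`.
  have hode : X * (X * (C (ν - 1) * P + C (ν - 2) * Q₁ - Q₂)) +
      X * (C (2 * κ) * Q₂ - C (2 * κ * (ν - 1)) * Q₁ + C (2 * (κ * ((ν - 1) / 2) ^ 2 - τ)) * P) +
      (C ν * Q₁ - Q₂) = 0 := by
    ext k
    rcases k with _ | _ | n
    · simp only [coeff_add, coeff_sub, coeff_C_mul, hq1, hq2, coeff_X_mul_zero, coeff_zero]
      push_cast; ring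
    · simp only [coeff_add, coeff_sub, coeff_C_mul, hq1, hq2, coeff_X_mul_zero, coeff_zero,
        coeff_X_mul]
      push_cast
      linear_combination h0
    · simp only [coeff_add, coeff_sub, coeff_C_mul, hq1, hq2, coeff_zero, coeff_X_mul]
      push_cast
      linear_combination hrec n
  intro hroot
  obtain ⟨g, hg, hdvd⟩ := exists_eq_pow_rootMultiplicity_mul_and_not_dvd P hP a
  have hmpos : 0 < P.rootMultiplicity a := (rootMultiplicity_pos hP).mpr hroot
  obtain ⟨m, hm⟩ := Nat.exists_eq_succ_of_ne_zero hmpos.ne'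
  rw [hm, Nat.succ_eq_add_one] at hg
  have hga : g.eval a ≠ 0 := fun h => hdvd (dvd_iff_isRoot.mpr h)
  set u : ℂ[X] := X - C a with hu
  have hdu : derivative u = 1 := by simp [hu]
  set g₁ := X * (C (m + 1 : ℂ) * g + u * derivative g) with hg₁
  have e1 : Q₁ = u ^ m * g₁ := by
    rw [hQ₁, hg, derivative_mul, derivative_pow_succ, hdu, hg₁]
    ring
  have e2 : u * Q₂ = u ^ m * (X * (C (m : ℂ) * g₁ + u * derivative g₁)) := by
    rw [hQ₂, e1, derivative_mul]
    cases m with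
    | zero => simp; ring
    | succ m =>
      rw [derivative_pow_succ, hdu]
      push_cast
      ring
  have hquad : X * X - C (2 * κ) * X + 1 = u * (X - C (2 * κ - a)) := by
    have h1 : (1 : ℂ[X]) = C (a * (2 * κ - a)) := by
      rw [← C_1]; congr 1; linear_combination ha
    rw [hu, h1]
    simp only [C_mul, C_sub]
    ring
  have hfac : u ^ m * (-((X - C (2 * κ - a)) * (X * (C (m : ℂ) * g₁ + u * derivative g₁))) +
      (X * X * C (ν - 2) - X * C (2 * κ * (ν - 1)) + C ν) * g₁ +
      (X * X * C (ν - 1) + X * C (2 * (κ * ((ν - 1) / 2) ^ 2 - τ))) * (u * g)) = 0 := by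
    have hs : u ^ m * (u * g) = P := by rw [hg]; ring
    linear_combination hode + (X - C (2 * κ - a)) * e2 - (X * X * C (ν - 2) -
      X * C (2 * κ * (ν - 1)) + C ν) * e1 + Q₂ * hquad + (X * X * C (ν - 1) +
      X * C (2 * (κ * ((ν - 1) / 2) ^ 2 - τ))) * hs
  have hu0 : u ^ m ≠ 0 := pow_ne_zero _ (X_sub_C_ne_zero a)
  have hev := congrArg (eval a) ((mul_eq_zero.mp hfac).resolve_left hu0)
  have hg₁a : g₁.eval a = a * ((m + 1) * g.eval a) := by simp [hg₁, hu]
  have hua : u.eval a = 0 := by simp [hu]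
  simp only [eval_add, eval_mul, eval_sub, eval_neg, eval_X, eval_C, hua, hg₁a, eval_zero,
    zero_mul, mul_zero, add_zero] at hev
  have hm1 : (m + 1 : ℂ) ≠ 0 := Nat.cast_add_one_ne_zero m
  -- The indicial equation: a zero of order m + 1 at `a` would require (m + 1)² = 0.
  have hfin : (1 - a ^ 2) * ((m + 1) * (a * ((m + 1) * g.eval a))) = 0 := by
    linear_combination hev + (m - ν + 1) * (a * ((m + 1) * g.eval a)) * ha
  have : (1 - a ^ 2) ≠ 0 := fun h => ha1 (by linear_combination -h)
  simp [this, hm1, ha0, hga] at hfin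

/-! ### The commuting tridiagonal matrix and its simple spectrum. -/

/-- Off-diagonal entries of the tridiagonal matrix commuting with the prolate matrix. -/
def prolateOffDiag (N : ℕ) (n : ℤ) : ℝ := n * (N - n) / 2

/-- The index measured from the midpoint of `0, …, N - 1`. -/
def centered (N : ℕ) (n : ℤ) : ℝ := n - (N - 1) / 2

/-- Diagonal entries of the tridiagonal matrix commuting with the prolate matrix. -/
def prolateDiag (N : ℕ) (W : ℝ) (n : ℤ) : ℝ := centered N n ^ 2 * Real.cos (2 * Real.pi * W)

/-- Slepian's tridiagonal matrix, which commutes with the prolate matrix. -/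
def tridiag (N : ℕ) (W : ℝ) (i j : ℤ) : ℝ :=
  if j = i then prolateDiag N W i
  else if j = i - 1 then prolateOffDiag N i
  else if j = i + 1 then prolateOffDiag N (i + 1) else 0

theorem tridiag_symm (N : ℕ) (W : ℝ) (i j : ℤ) : tridiag N W i j = tridiag N W j i := by
  unfold tridiag
  split_ifs <;> first | omega | rfl | (congr 1 <;> omega)

theorem tridiag_reverse (N : ℕ) (W : ℝ) (i j : ℤ) :
    tridiag N W (N - 1 - i) (N - 1 - j) = tridiag N W i j := by
  unfold tridiag
  split_ifs <;>
    first
    | omega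
    | rfl
    | (simp only [prolateDiag, prolateOffDiag, centered]; push_cast; ring)

theorem sum_fin_ite_eq (N : ℕ) (k : ℤ) (y : ℝ) :
    ∑ j : Fin N, (if ((j : ℕ) : ℤ) = k then y else 0) = if 0 ≤ k ∧ k < N then y else 0 := by
  split_ifs with h
  · rw [Finset.sum_eq_single ⟨k.toNat, by omega⟩]
    · rw [if_pos]; simp [h.1]
    · intro j _ hj
      rw [if_neg]
      intro h'
      exact hj (Fin.ext (by simp only; omega))
    · simp
  · refine Finset.sum_eq_zero fun j _ => ?_
    rw [if_neg]
    intro h'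
    have := j.2
    omega

theorem sum_tridiag_mul (N : ℕ) (W : ℝ) (x : ℤ → ℝ) (i : Fin N) :
    ∑ j : Fin N, tridiag N W ((i : ℕ) : ℤ) ((j : ℕ) : ℤ) * x ((j : ℕ) : ℤ) =
      prolateOffDiag N (i : ℕ) * x ((i : ℕ) - 1) + prolateDiag N W (i : ℕ) * x (i : ℕ) +
        prolateOffDiag N ((i : ℕ) + 1) * x ((i : ℕ) + 1) := by
  have h : ∀ j : Fin N, tridiag N W ((i : ℕ) : ℤ) ((j : ℕ) : ℤ) * x ((j : ℕ) : ℤ) =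
      (if ((j : ℕ) : ℤ) = ((i : ℕ) : ℤ) - 1 then
        prolateOffDiag N (i : ℕ) * x ((i : ℕ) - 1) else 0) +
      (if ((j : ℕ) : ℤ) = ((i : ℕ) : ℤ) then prolateDiag N W (i : ℕ) * x (i : ℕ) else 0) +
      (if ((j : ℕ) : ℤ) = ((i : ℕ) : ℤ) + 1 then
        prolateOffDiag N ((i : ℕ) + 1) * x ((i : ℕ) + 1) else 0) := by
    intro j
    generalize ((j : ℕ) : ℤ) = j'
    unfold tridiag
    split_ifs <;> first | omega | (subst_vars; ring)
  simp only [h, Finset.sum_add_distrib, sum_fin_ite_eq]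
  have hi := i.2
  congr 1
  · congr 1
    · split_ifs with h1
      · rfl
      · have : ((i : ℕ) : ℤ) = 0 := by omega
        simp [this, prolateOffDiag]
    · rw [if_pos (by omega)]
  · split_ifs with h1
    · rfl
    · have : ((i : ℕ) : ℤ) + 1 = N := by omega
      simp [this, prolateOffDiag]

/-- For each kernel value, the coefficients on the two sides differ by a multiple of N - 1 - m - n
times the kernel's argument. `mul_prolateKernel` turns these products into sines, which cancel by
the addition formulas. -/
theorem tridiag_comm_aux (N : ℕ) (W : ℝ) (m n : ℤ) :
    prolateOffDiag N m * prolateKernel W (m - 1 - n) + prolateDiag N W m * prolateKernel W (m - n) +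
      prolateOffDiag N (m + 1) * prolateKernel W (m + 1 - n) =
    prolateOffDiag N n * prolateKernel W (m - (n - 1)) + prolateDiag N W n * prolateKernel W (m - n) +
      prolateOffDiag N (n + 1) * prolateKernel W (m - (n + 1)) := by
  have h1 := mul_prolateKernel W (m - n - 1)
  have h2 := mul_prolateKernel W (m - n)
  have h3 := mul_prolateKernel W (m - n + 1)
  rw [show m - 1 - n = m - n - 1 by ring, show m + 1 - n = m - n + 1 by ring,
    show m - (n - 1) = m - n + 1 by ring, show m - (n + 1) = m - n - 1 by ring]
  have hs : Real.sin (2 * Real.pi * W * ((m - n - 1 : ℤ) : ℝ)) +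
      Real.sin (2 * Real.pi * W * ((m - n + 1 : ℤ) : ℝ)) =
      2 * Real.cos (2 * Real.pi * W) * Real.sin (2 * Real.pi * W * ((m - n : ℤ) : ℝ)) := by
    have e1 : 2 * Real.pi * W * ((m - n - 1 : ℤ) : ℝ) =
      2 * Real.pi * W * ((m - n : ℤ) : ℝ) - 2 * Real.pi * W := by push_cast; ring
    have e2 : 2 * Real.pi * W * ((m - n + 1 : ℤ) : ℝ) =
      2 * Real.pi * W * ((m - n : ℤ) : ℝ) + 2 * Real.pi * W := by push_cast; ring
    rw [e1, e2, Real.sin_sub, Real.sin_add]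
    ring
  unfold prolateOffDiag prolateDiag centered
  push_cast at h1 h2 h3 hs ⊢
  linear_combination ((N : ℝ) - 1 - m - n) / 2 * h1 + ((N : ℝ) - 1 - m - n) / 2 * h3 -
    ((N : ℝ) - 1 - m - n) * Real.cos (2 * Real.pi * W) * h2 +
    ((N : ℝ) - 1 - m - n) / (2 * Real.pi) * hs

/-- Eigenvectors of the tridiagonal matrix. -/
def IsTridiagEigenvector {N : ℕ} (W τ : ℝ) (v : Fin N → ℝ) : Prop :=
  ∀ m : Fin N, ∑ n : Fin N, tridiag N W ((m : ℕ) : ℤ) ((n : ℕ) : ℤ) * v n = τ * v m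

/-- The prolate matrix applied to a vector. -/
def prolateApply {N : ℕ} (W : ℝ) (v : Fin N → ℝ) (m : Fin N) : ℝ :=
  ∑ n : Fin N, prolateKernel W ((m : ℕ) - (n : ℕ)) * v n

theorem IsTridiagEigenvector.prolateApply {N : ℕ} {W τ : ℝ} {v : Fin N → ℝ}
    (hv : IsTridiagEigenvector W τ v) : IsTridiagEigenvector W τ (prolateApply W v) := by
  intro m
  calc ∑ j : Fin N, tridiag N W ((m : ℕ) : ℤ) ((j : ℕ) : ℤ) * _root_.prolateApply W v j
      = ∑ n : Fin N, (∑ j : Fin N, tridiag N W ((m : ℕ) : ℤ) ((j : ℕ) : ℤ) *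
          prolateKernel W (((j : ℕ) : ℤ) - (n : ℕ))) * v n := by
        simp only [_root_.prolateApply, Finset.mul_sum, Finset.sum_mul]
        rw [Finset.sum_comm]
        exact Finset.sum_congr rfl fun _ _ => Finset.sum_congr rfl fun _ _ => by ring
    _ = ∑ n : Fin N, (∑ j : Fin N, tridiag N W ((n : ℕ) : ℤ) ((j : ℕ) : ℤ) *
          prolateKernel W ((m : ℕ) - ((j : ℕ) : ℤ))) * v n := by
        refine Finset.sum_congr rfl fun n _ => ?_
        rw [sum_tridiag_mul N W (fun j => prolateKernel W (j - (n : ℕ))),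
          sum_tridiag_mul N W (fun j => prolateKernel W ((m : ℕ) - j)), tridiag_comm_aux]
    _ = ∑ j : Fin N, prolateKernel W ((m : ℕ) - ((j : ℕ) : ℤ)) *
          ∑ n : Fin N, tridiag N W ((j : ℕ) : ℤ) ((n : ℕ) : ℤ) * v n := by
        simp only [Finset.mul_sum, Finset.sum_mul]
        rw [Finset.sum_comm]
        refine Finset.sum_congr rfl fun j _ => Finset.sum_congr rfl fun n _ => ?_
        rw [tridiag_symm N W ((n : ℕ) : ℤ)]
        ring
    _ = τ * _root_.prolateApply W v m := by
        rw [_root_.prolateApply, Finset.mul_sum]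
        refine Finset.sum_congr rfl fun j _ => ?_
        rw [hv j]; ring

/-- Extension of a finite vector by zero. -/
def zeroExtend {N : ℕ} (v : Fin N → ℝ) (n : ℤ) : ℝ :=
  if h : 0 ≤ n ∧ n < N then v ⟨n.toNat, by omega⟩ else 0

@[simp] theorem zeroExtend_coe {N : ℕ} (v : Fin N → ℝ) (n : Fin N) :
    zeroExtend v ((n : ℕ) : ℤ) = v n := by
  unfold zeroExtend
  rw [dif_pos ⟨by omega, by have := n.2; omega⟩]
  congr 1

theorem zeroExtend_of_not {N : ℕ} (v : Fin N → ℝ) {n : ℤ} (h : ¬(0 ≤ n ∧ n < N)) :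
    zeroExtend v n = 0 := dif_neg h

/-- Holds for every natural `n`, also beyond the range, because the off-diagonal entry vanishes at 0
and `N`; the polynomial argument needs all coefficients. -/
theorem IsTridiagEigenvector.recurrence {N : ℕ} {W τ : ℝ} {v : Fin N → ℝ}
    (hv : IsTridiagEigenvector W τ v) (n : ℕ) :
    prolateOffDiag N n * zeroExtend v (n - 1) + prolateDiag N W n * zeroExtend v n +
      prolateOffDiag N (n + 1) * zeroExtend v (n + 1) = τ * zeroExtend v n := by
  by_cases hn : n < N
  · have := hv ⟨n, hn⟩
    have h2 := sum_tridiag_mul N W (zeroExtend v) ⟨n, hn⟩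
    simp only [zeroExtend_coe] at h2
    rw [h2] at this
    rw [this]
    congr 1
    exact (zeroExtend_coe v ⟨n, hn⟩).symm
  · rw [zeroExtend_of_not v (n := (n : ℤ)) (by omega),
      zeroExtend_of_not v (n := (n : ℤ) + 1) (by omega)]
    rcases eq_or_ne n N with h | h
    · simp [h, prolateOffDiag]
    · rw [zeroExtend_of_not v (n := (n : ℤ) - 1) (by omega)]; simp

/-- The off-diagonal entries at 1, …, N-1 are nonzero, so the recurrence determines the vector from
its first entry. Hence the eigenspaces are lines. -/
theorem IsTridiagEigenvector.eq_zero {N : ℕ} {W τ : ℝ} {v : Fin N → ℝ}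
    (hv : IsTridiagEigenvector W τ v) (h0 : zeroExtend v 0 = 0) : v = 0 := by
  have key : ∀ n : ℕ, zeroExtend v ((n : ℤ) - 1) = 0 ∧ zeroExtend v n = 0 := by
    intro n
    induction n with
    | zero => exact ⟨zeroExtend_of_not v (by simp), by simpa using h0⟩
    | succ n ih =>
      refine ⟨by push_cast; simpa using ih.2, ?_⟩
      push_cast
      by_cases hn : n + 1 < N
      · have h := hv.recurrence n
        rw [ih.1, ih.2] at h
        simp only [mul_zero, zero_add] at h
        refine (mul_eq_zero.mp h).resolve_left ?_
        have h1 : (n : ℝ) + 1 < N := by exact_mod_cast hn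
        have h2 : (0 : ℝ) < n + 1 := by positivity
        have : 0 < prolateOffDiag N (n + 1) := by
          unfold prolateOffDiag
          push_cast
          have : (0 : ℝ) < N - (n + 1) := by linarith
          positivity
        exact this.ne'
      · exact zeroExtend_of_not v (by omega)
  funext n
  have := (key n).2
  simpa using this

theorem IsTridiagEigenvector.exists_eq_smul {N : ℕ} {W τ : ℝ} {u v : Fin N → ℝ}
    (hu : IsTridiagEigenvector W τ u) (hv : IsTridiagEigenvector W τ v) (hv0 : v ≠ 0) :
    ∃ c : ℝ, ∀ n, u n = c * v n := by
  have h0 : zeroExtend v 0 ≠ 0 := fun h => hv0 (hv.eq_zero h)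
  refine ⟨zeroExtend u 0 / zeroExtend v 0, fun n => ?_⟩
  set c := zeroExtend u 0 / zeroExtend v 0 with hc
  have hw : IsTridiagEigenvector W τ (fun n => u n - c * v n) := by
    intro m
    have h1 := hu m
    have h2 := hv m
    simp only [mul_sub, Finset.sum_sub_distrib]
    rw [h1]
    have : ∑ n : Fin N, tridiag N W ((m : ℕ) : ℤ) ((n : ℕ) : ℤ) * (c * v n) =
        c * (τ * v m) := by
      rw [← h2, Finset.mul_sum]
      exact Finset.sum_congr rfl fun _ _ => by ring
    rw [this]; ring
  have hz : zeroExtend (fun n => u n - c * v n) 0 = 0 := by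
    have : ∀ k, zeroExtend (fun n => u n - c * v n) k = zeroExtend u k - c * zeroExtend v k := by
      intro k
      unfold zeroExtend
      split_ifs <;> simp
    rw [this, hc]; field_simp; ring
  have := congrFun (hw.eq_zero hz) n
  simp only [Pi.zero_apply] at this
  linarith

theorem coe_rev_int {N : ℕ} (n : Fin N) : ((n.rev : ℕ) : ℤ) = N - 1 - (n : ℕ) := by
  rw [Fin.val_rev]; have := n.2; omega

theorem IsTridiagEigenvector.rev {N : ℕ} {W τ : ℝ} {v : Fin N → ℝ}
    (hv : IsTridiagEigenvector W τ v) : IsTridiagEigenvector W τ fun n => v n.rev := by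
  intro m
  rw [← hv m.rev, ← Equiv.sum_comp Fin.revPerm]
  refine Finset.sum_congr rfl fun n _ => ?_
  simp only [Fin.revPerm_apply, Fin.rev_rev, coe_rev_int]
  rw [← tridiag_reverse N W ((m : ℕ) : ℤ)]
  congr 2
  ring

/-- Reversal preserves the one-dimensional eigenspace, so it acts there by a scalar of square 1. -/
theorem IsTridiagEigenvector.exists_parity {N : ℕ} {W τ : ℝ} {v : Fin N → ℝ}
    (hv : IsTridiagEigenvector W τ v) (hv0 : v ≠ 0) :
    ∃ σ : ℝ, (σ = 1 ∨ σ = -1) ∧ ∀ n, v n.rev = σ * v n := by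
  obtain ⟨c, hc⟩ := hv.rev.exists_eq_smul hv hv0
  refine ⟨c, ?_, hc⟩
  obtain ⟨n, hn⟩ := Function.ne_iff.mp hv0
  have h1 := hc n.rev
  rw [Fin.rev_rev, hc n] at h1
  have h2 : (c * c - 1) * v n = 0 := by linarith
  have h3 : c * c - 1 = 0 := (mul_eq_zero.mp h2).resolve_right hn
  exact mul_self_eq_one_iff.mp (by linarith)

/-! ### Frequency response at the band edge. -/

/-- The even part of the frequency response at the band edge. -/
def edgeCos {N : ℕ} (W : ℝ) (v : Fin N → ℝ) : ℝ :=
  ∑ n : Fin N, v n * Real.cos (2 * Real.pi * W * centered N (n : ℕ))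

/-- The odd part of the frequency response at the band edge. -/
def edgeSin {N : ℕ} (W : ℝ) (v : Fin N → ℝ) : ℝ :=
  ∑ n : Fin N, v n * Real.sin (2 * Real.pi * W * centered N (n : ℕ))

open Polynomial in
/-- Eigenvectors of the tridiagonal matrix have a frequency response that does not vanish at the
band edge. -/
theorem IsTridiagEigenvector.edge_ne_zero {N : ℕ} {W τ : ℝ} {v : Fin N → ℝ} (hW0 : 0 < W)
    (hW1 : W < 1 / 2) (hv : IsTridiagEigenvector W τ v) (hv0 : v ≠ 0) :
    ¬(edgeCos W v = 0 ∧ edgeSin W v = 0) := by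
  rintro ⟨hC, hS⟩
  set θ := 2 * Real.pi * W with hθ
  have hpi := Real.pi_pos
  have hsin : Real.sin θ ≠ 0 :=
    (Real.sin_pos_of_pos_of_lt_pi (by positivity) (by rw [hθ]; nlinarith)).ne'
  set a : ℂ := Complex.exp (θ * Complex.I) with ha
  have ha_eq : a = Real.cos θ + Real.sin θ * Complex.I := by
    rw [ha, Complex.exp_mul_I]; push_cast; rfl
  have hcs : (Real.cos θ : ℂ) ^ 2 + (Real.sin θ : ℂ) ^ 2 = 1 := by
    exact_mod_cast Real.cos_sq_add_sin_sq θ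
  have hrel : a ^ 2 + 1 = 2 * (Real.cos θ : ℂ) * a := by
    rw [ha_eq]
    linear_combination (Real.sin θ : ℂ) ^ 2 * Complex.I_sq - hcs
  have ha1 : a ^ 2 ≠ 1 := by
    intro h
    have h2 : (Real.sin θ : ℂ) * (a * Complex.I) = 0 := by
      rw [ha_eq] at h ⊢
      linear_combination (1 / 2 : ℂ) * h + (1 / 2 : ℂ) * (Real.sin θ : ℂ) ^ 2 * Complex.I_sq -
        (1 / 2 : ℂ) * hcs
    have ha0 : a ≠ 0 := Complex.exp_ne_zero _
    have hs : (Real.sin θ : ℂ) ≠ 0 := by exact_mod_cast hsin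
    exact (mul_ne_zero hs (mul_ne_zero ha0 Complex.I_ne_zero)) h2
  set P : ℂ[X] := ∑ n ∈ Finset.range N, C (zeroExtend v n : ℂ) * X ^ n with hP
  have hcoeff : ∀ k : ℕ, P.coeff k = (zeroExtend v k : ℂ) := by
    intro k
    rw [hP, finsetSum_coeff]
    simp only [coeff_C_mul, coeff_X_pow, mul_ite, mul_one, mul_zero]
    rw [Finset.sum_ite_eq]
    split_ifs with hk
    · rfl
    · rw [Finset.mem_range] at hk
      rw [zeroExtend_of_not v (by omega), Complex.ofReal_zero]
  have hP0 : P ≠ 0 := by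
    intro h
    apply hv0
    funext n
    have := hcoeff n
    rw [h, coeff_zero, zeroExtend_coe] at this
    exact_mod_cast this.symm
  refine eval_ne_zero_of_recurrence (P := P) (ν := N) (κ := Real.cos θ) (τ := τ) hP0 ?_ ?_ hrel
    ha1 ?_
  · rw [hcoeff, hcoeff]
    have h := hv.recurrence 0
    unfold prolateOffDiag prolateDiag centered at h
    have h' : 2 * (Real.cos θ * (((N : ℝ) - 1) / 2) ^ 2 - τ) * zeroExtend v (0 : ℕ) +
        ((N : ℝ) - 1) * zeroExtend v (1 : ℕ) = 0 := by
      push_cast at h ⊢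
      linear_combination 2 * h
    exact_mod_cast h'
  · intro n
    rw [hcoeff, hcoeff, hcoeff]
    have h := hv.recurrence (n + 1)
    unfold prolateOffDiag prolateDiag centered at h
    have e1 : (((n + 1 : ℕ) : ℤ) - 1) = (n : ℕ) := by push_cast; ring
    have e2 : (((n + 1 : ℕ) : ℤ) + 1) = (n + 2 : ℕ) := by push_cast; ring
    rw [e1, e2] at h
    have h' : ((n : ℝ) + 1) * (N - n - 1) * zeroExtend v (n : ℕ) +
        2 * (Real.cos θ * (n + 1 - ((N : ℝ) - 1) / 2) ^ 2 - τ) * zeroExtend v (n + 1 : ℕ) +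
        ((n : ℝ) + 2) * (N - n - 2) * zeroExtend v (n + 2 : ℕ) = 0 := by
      push_cast at h ⊢
      linear_combination 2 * h
    exact_mod_cast h'
  · rw [hP, eval_finsetSum]
    simp only [eval_mul, eval_C, eval_pow, eval_X]
    rw [Finset.sum_range fun n => (zeroExtend v (n : ℕ) : ℂ) * a ^ n]
    simp only [zeroExtend_coe]
    -- Centering the index shows that P(a) is a unimodular phase times `edgeCos` + i·`edgeSin`.
    have h1 : ∀ n : Fin N, (v n : ℂ) * a ^ (n : ℕ) =
        Complex.exp ((θ * ((N : ℝ) - 1) / 2 : ℝ) * Complex.I) *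
        (((v n * Real.cos (θ * centered N (n : ℕ)) : ℝ) : ℂ) +
          ((v n * Real.sin (θ * centered N (n : ℕ)) : ℝ) : ℂ) * Complex.I) := by
      intro n
      have : a ^ (n : ℕ) = Complex.exp ((θ * ((N : ℝ) - 1) / 2 : ℝ) * Complex.I) *
          Complex.exp ((θ * centered N (n : ℕ) : ℝ) * Complex.I) := by
        rw [ha, ← Complex.exp_nat_mul, ← Complex.exp_add]
        congr 1
        unfold centered
        push_cast
        ring
      rw [this, Complex.exp_mul_I ((θ * centered N (n : ℕ) : ℝ) : ℂ), ← Complex.ofReal_cos,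
        ← Complex.ofReal_sin]
      push_cast
      ring
    simp only [h1]
    rw [← Finset.mul_sum, Finset.sum_add_distrib, ← Finset.sum_mul, ← Complex.ofReal_sum,
      ← Complex.ofReal_sum]
    unfold edgeCos at hC
    unfold edgeSin at hS
    rw [hC, hS]
    simp

theorem centered_rev {N : ℕ} (n : Fin N) :
    centered N ((n.rev : ℕ) : ℤ) = -centered N ((n : ℕ) : ℤ) := by
  rw [coe_rev_int]
  unfold centered
  push_cast
  ring

theorem edgeCos_of_parity {N : ℕ} {σ : ℝ} {v : Fin N → ℝ} (W : ℝ)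
    (hv : ∀ n, v n.rev = σ * v n) : edgeCos W v = σ * edgeCos W v := by
  conv_lhs => rw [edgeCos, ← Equiv.sum_comp Fin.revPerm]
  rw [edgeCos, Finset.mul_sum]
  refine Finset.sum_congr rfl fun n _ => ?_
  rw [Fin.revPerm_apply, centered_rev, hv, mul_neg, Real.cos_neg]
  ring

theorem edgeSin_of_parity {N : ℕ} {σ : ℝ} {v : Fin N → ℝ} (W : ℝ)
    (hv : ∀ n, v n.rev = σ * v n) : edgeSin W v = -σ * edgeSin W v := by
  conv_lhs => rw [edgeSin, ← Equiv.sum_comp Fin.revPerm]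
  rw [edgeSin, Finset.mul_sum]
  refine Finset.sum_congr rfl fun n _ => ?_
  rw [Fin.revPerm_apply, centered_rev, hv, mul_neg, Real.sin_neg]
  ring

/-! ### Simplicity of the prolate spectrum. -/

/-- The commutator of the prolate matrix with multiplication by the centered index has rank two. -/
theorem IsProlateEigenvector.sum_centered_mul {N : ℕ} {W β : ℝ} {v : Fin N → ℝ}
    (hv : IsProlateEigenvector W β v) (m : Fin N) :
    ∑ n : Fin N, prolateKernel W ((m : ℕ) - (n : ℕ)) * (centered N (n : ℕ) * v n) =
      β * (centered N (m : ℕ) * v m) -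
        (Real.sin (2 * Real.pi * W * centered N (m : ℕ)) * edgeCos W v -
          Real.cos (2 * Real.pi * W * centered N (m : ℕ)) * edgeSin W v) / Real.pi := by
  have h : ∀ n : Fin N, prolateKernel W ((m : ℕ) - (n : ℕ)) * (centered N (n : ℕ) * v n) =
      centered N (m : ℕ) * (prolateKernel W ((m : ℕ) - (n : ℕ)) * v n) -
      (Real.sin (2 * Real.pi * W * centered N (m : ℕ)) *
          (v n * Real.cos (2 * Real.pi * W * centered N (n : ℕ))) -
        Real.cos (2 * Real.pi * W * centered N (m : ℕ)) *
          (v n * Real.sin (2 * Real.pi * W * centered N (n : ℕ)))) / Real.pi := by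
    intro n
    have h1 := mul_prolateKernel W ((m : ℕ) - (n : ℕ))
    have h2 : 2 * Real.pi * W * ((((m : ℕ) : ℤ) - ((n : ℕ) : ℤ) : ℤ) : ℝ) =
        2 * Real.pi * W * centered N (m : ℕ) - 2 * Real.pi * W * centered N (n : ℕ) := by
      unfold centered; push_cast; ring
    rw [h2, Real.sin_sub] at h1
    have h3 : ((((m : ℕ) : ℤ) - ((n : ℕ) : ℤ) : ℤ) : ℝ) =
        centered N (m : ℕ) - centered N (n : ℕ) := by
      unfold centered; push_cast; ring
    rw [h3] at h1
    linear_combination (-v n) * h1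
  simp only [h]
  rw [Finset.sum_sub_distrib, ← Finset.mul_sum, hv m, ← Finset.sum_div, Finset.sum_sub_distrib,
    ← Finset.mul_sum, ← Finset.mul_sum, edgeCos, edgeSin]
  ring

theorem IsProlateEigenvector.sum_mul_sum {N : ℕ} {W β : ℝ} {u : Fin N → ℝ}
    (hu : IsProlateEigenvector W β u) (x : Fin N → ℝ) :
    ∑ m : Fin N, u m * ∑ n : Fin N, prolateKernel W ((m : ℕ) - (n : ℕ)) * x n =
      β * ∑ n, u n * x n := by
  simp only [Finset.mul_sum]
  rw [Finset.sum_comm]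
  refine Finset.sum_congr rfl fun n _ => ?_
  rw [← mul_assoc, ← hu n, Finset.sum_mul]
  refine Finset.sum_congr rfl fun m _ => ?_
  rw [← prolateKernel_neg, neg_sub]
  ring

/-- The boundary form vanishes on each eigenspace of the prolate matrix. -/
theorem IsProlateEigenvector.edge_cross {N : ℕ} {W β : ℝ} {u v : Fin N → ℝ}
    (hu : IsProlateEigenvector W β u) (hv : IsProlateEigenvector W β v) :
    edgeSin W u * edgeCos W v = edgeCos W u * edgeSin W v := by
  -- Pairing `u` with the commutator applied to `v` gives zero by symmetry, since the eigenvalues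
  -- agree; the rank-two formula gives the boundary form.
  have h := hu.sum_mul_sum fun n => centered N (n : ℕ) * v n
  simp only [hv.sum_centered_mul] at h
  have h2 : ∀ m : Fin N, u m * (β * (centered N (m : ℕ) * v m) -
        (Real.sin (2 * Real.pi * W * centered N (m : ℕ)) * edgeCos W v -
          Real.cos (2 * Real.pi * W * centered N (m : ℕ)) * edgeSin W v) / Real.pi) =
      β * (u m * (centered N (m : ℕ) * v m)) -
        ((u m * Real.sin (2 * Real.pi * W * centered N (m : ℕ))) * edgeCos W v -
          (u m * Real.cos (2 * Real.pi * W * centered N (m : ℕ))) * edgeSin W v) / Real.pi :=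
    fun m => by ring
  simp only [h2] at h
  rw [Finset.sum_sub_distrib, ← Finset.mul_sum, ← Finset.sum_div, Finset.sum_sub_distrib,
    ← Finset.sum_mul, ← Finset.sum_mul, ← edgeCos, ← edgeSin] at h
  have h3 : (edgeSin W u * edgeCos W v - edgeCos W u * edgeSin W v) / Real.pi = 0 := by linarith
  rw [div_eq_zero_iff, or_iff_left Real.pi_ne_zero] at h3
  linarith

theorem sum_mul_eq_zero_of_parity {N : ℕ} {σ : ℝ} {u v : Fin N → ℝ} (hσ : σ = 1 ∨ σ = -1)
    (hu : ∀ n, u n.rev = σ * u n) (hv : ∀ n, v n.rev = -σ * v n) : ∑ n, u n * v n = 0 := by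
  have h : ∑ n, u n * v n = -∑ n, u n * v n := by
    conv_lhs => rw [← Equiv.sum_comp Fin.revPerm]
    rw [← Finset.sum_neg_distrib]
    refine Finset.sum_congr rfl fun n _ => ?_
    rw [Fin.revPerm_apply, hu, hv]
    rcases hσ with rfl | rfl <;> ring
  linarith

/-- Simplicity of the spectrum of the prolate matrix. -/
theorem prolate_eigenvalues_injective {N : ℕ} {W : ℝ} {t : Fin N → Fin N → ℝ} {β σ : Fin N → ℝ}
    (horth : ∀ i j, ∑ n, t i n * t j n = if i = j then 1 else 0)
    (hcomplete : ∀ y : Fin N → ℝ, (∀ k, ∑ n, t k n * y n = 0) → y = 0)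
    (ht : ∀ i, IsProlateEigenvector W (β i) (t i)) (hσ : ∀ i, σ i = 1 ∨ σ i = -1)
    (hpar : ∀ i n, t i n.rev = σ i * t i n)
    (hedge : ∀ i, ¬(edgeCos W (t i) = 0 ∧ edgeSin W (t i) = 0)) : Function.Injective β := by
  have heven : ∀ i, σ i = 1 → edgeSin W (t i) = 0 := fun i hi => by
    have := edgeSin_of_parity W (hpar i); rw [hi] at this; linarith
  have hodd : ∀ i, σ i = -1 → edgeCos W (t i) = 0 := fun i hi => by
    have := edgeCos_of_parity W (hpar i); rw [hi] at this; linarith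
  have hcross : ∀ i j, β i = β j →
      edgeSin W (t i) * edgeCos W (t j) = edgeCos W (t i) * edgeSin W (t j) := fun i j hij =>
    (ht i).edge_cross (hij ▸ ht j)
  -- An even and an odd eigenvector cannot share an eigenvalue: the boundary form would reduce to a
  -- product of two nonzero edge values.
  have hne : ∀ i j, β i = β j → σ i = 1 → σ j = -1 → False := fun i j hij hi hj => by
    have h := hcross i j hij
    rw [heven i hi, zero_mul, eq_comm, mul_eq_zero] at h
    rcases h with h | h
    · exact hedge i ⟨h, heven i hi⟩
    · exact hedge j ⟨hodd j hj, h⟩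
  have hsame : ∀ i j, β i = β j → σ i = σ j := fun i j hij => by
    rcases hσ i with hi | hi <;> rcases hσ j with hj | hj
    · rw [hi, hj]
    · exact (hne i j hij hi hj).elim
    · exact (hne j i hij.symm hj hi).elim
    · rw [hi, hj]
  intro i j hij
  by_contra hij0
  set p := edgeCos W (t i) + edgeSin W (t i) with hp
  set q := edgeCos W (t j) + edgeSin W (t j) with hq
  have hq0 : q ≠ 0 := by
    intro h
    rcases hσ j with hj | hj
    · have h2 := heven j hj
      exact hedge j ⟨by linarith, h2⟩
    · have h2 := hodd j hj
      exact hedge j ⟨h2, by linarith⟩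
  -- The combination in the common eigenspace for which both edge values vanish, so that the
  -- commutator kills it.
  set w : Fin N → ℝ := fun n => q * t i n - p * t j n with hw
  have hC : edgeCos W w = 0 := by
    have : edgeCos W w = q * edgeCos W (t i) - p * edgeCos W (t j) := by
      simp only [edgeCos, hw, Finset.mul_sum, ← Finset.sum_sub_distrib]
      exact Finset.sum_congr rfl fun _ _ => by ring
    rw [this, hp, hq]
    linear_combination -hcross i j hij
  have hS : edgeSin W w = 0 := by
    have : edgeSin W w = q * edgeSin W (t i) - p * edgeSin W (t j) := by
      simp only [edgeSin, hw, Finset.mul_sum, ← Finset.sum_sub_distrib]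
      exact Finset.sum_congr rfl fun _ _ => by ring
    rw [this, hp, hq]
    linear_combination hcross i j hij
  have hwB : IsProlateEigenvector W (β i) w := by
    intro m
    have h1 := ht i m
    have h2 := ht j m
    rw [← hij] at h2
    calc _ = q * (β i * t i m) - p * (β i * t j m) := by
          rw [← h1, ← h2, Finset.mul_sum, Finset.mul_sum, ← Finset.sum_sub_distrib]
          exact Finset.sum_congr rfl fun _ _ => by simp only [hw]; ring
      _ = _ := by simp only [hw]; ring
  have hwpar : ∀ n, w n.rev = σ i * w n := by
    intro n
    simp only [hw]
    rw [hpar i, hpar j, ← hsame i j hij]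
    ring
  -- `y` lies in the same eigenspace as `w` but has the opposite parity; that eigenspace has only
  -- one parity, so y = 0.
  set y : Fin N → ℝ := fun n => centered N (n : ℕ) * w n with hy
  have hyB : IsProlateEigenvector W (β i) y := by
    intro m
    have := hwB.sum_centered_mul m
    rw [hC, hS] at this
    simpa [hy] using this
  have hypar : ∀ n, y n.rev = -σ i * y n := by
    intro n
    simp only [hy]
    rw [centered_rev, hwpar]
    ring
  have hy0 : y = 0 := by
    refine hcomplete y fun k => ?_
    by_cases hk : β k = β i
    · refine sum_mul_eq_zero_of_parity (hσ k) (hpar k) ?_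
      rw [hsame k i hk]; exact hypar
    · exact (ht k).sum_mul_eq_zero hyB hk
  have hw0 : w = 0 := by
    by_contra hne0
    obtain ⟨n₀, hn₀⟩ := Function.ne_iff.mp hne0
    have hcen : ∀ n, w n ≠ 0 → centered N ((n : ℕ) : ℤ) = 0 := fun n hn => by
      have := congrFun hy0 n
      simp only [hy, Pi.zero_apply] at this
      exact (mul_eq_zero.mp this).resolve_right hn
    -- With y = 0, `w` can only live at the midpoint, where the cosine is 1; its vanishing edge
    -- value then makes it zero.
    have hval : edgeCos W w = w n₀ := by
      rw [edgeCos, Finset.sum_eq_single n₀]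
      · rw [hcen n₀ hn₀]; simp
      · intro n _ hn
        by_cases hwn : w n = 0
        · rw [hwn, zero_mul]
        · exfalso
          have h1 := hcen n hwn
          have h2 := hcen n₀ hn₀
          unfold centered at h1 h2
          have h3 : (((n : ℕ) : ℤ) : ℝ) = (((n₀ : ℕ) : ℤ) : ℝ) := by linarith
          exact hn (Fin.ext (by exact_mod_cast h3))
      · simp
    exact hn₀ (by rw [← hval, hC]; rfl)
  have hpair : ∑ n, t i n * w n = q := by
    have : ∑ n, t i n * w n = q * ∑ n, t i n * t i n - p * ∑ n, t i n * t j n := by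
      simp only [hw, Finset.mul_sum, ← Finset.sum_sub_distrib]
      exact Finset.sum_congr rfl fun _ _ => by ring
    rw [this, horth, horth, if_pos rfl, if_neg hij0]
    ring
  rw [hw0] at hpair
  simp at hpair
  exact hq0 hpair.symm

/-! ### Eigenvalues strictly between 0 and 1, and existence of the DPSS's. -/

/-- The response is a polynomial evaluated on the unit circle. An interval shorter than 1 maps
injectively to the circle and would provide infinitely many roots. -/
theorem exists_freqResponse_ne_zero {N : ℕ} {a b : ℝ} (hab : a < b) (hb : b < a + 1)
    {v : Fin N → ℂ} (hv : v ≠ 0) : ∃ f ∈ Set.Icc a b, freqResponse v f ≠ 0 := by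
  by_contra! h
  set P : Polynomial ℂ := ∑ n : Fin N, Polynomial.C (v n) * Polynomial.X ^ (n : ℕ) with hP
  have heval : ∀ f, P.eval (fourierChar f (-1)) = freqResponse v f := by
    intro f
    rw [hP, Polynomial.eval_finsetSum, freqResponse]
    refine Finset.sum_congr rfl fun n _ => ?_
    simp [fourierChar_nat]
  have hinj : Set.InjOn (fun f => fourierChar f (-1)) (Set.Icc a b) := by
    intro f hf g hg hfg
    simp only [fourierChar] at hfg
    rw [Complex.exp_eq_exp_iff_exists_int] at hfg
    obtain ⟨n, hn⟩ := hfg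
    have h2 : (2 * Real.pi * Complex.I : ℂ) ≠ 0 := Complex.two_pi_I_ne_zero
    have h3 : (2 * Real.pi * Complex.I : ℂ) * (g : ℂ) = (2 * Real.pi * Complex.I) * (f + n) := by
      push_cast at hn
      linear_combination hn
    have h4 : (g : ℂ) = f + n := mul_left_cancel₀ h2 h3
    have h5 : g = f + n := by exact_mod_cast h4
    have h6 : (n : ℝ) < 1 := by linarith [hf.1, hg.2]
    have h7 : (-1 : ℝ) < n := by linarith [hf.2, hg.1]
    have h8 : n < 1 := by exact_mod_cast h6
    have h9 : -1 < n := by exact_mod_cast h7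
    have h10 : n = 0 := by omega
    rw [h5, h10]; simp
  have hinf : Set.Infinite {x | P.IsRoot x} := by
    refine ((Set.Icc_infinite hab).image hinj).mono ?_
    rintro _ ⟨f, hf, rfl⟩
    change P.eval _ = 0
    rw [heval, h f hf]
  have hP0 := Polynomial.eq_zero_of_infinite_isRoot P hinf
  apply hv
  funext n
  have hc : P.coeff n = v n := by
    rw [hP, Polynomial.finsetSum_coeff]
    simp only [Polynomial.coeff_C_mul, Polynomial.coeff_X_pow, mul_ite, mul_one, mul_zero]
    rw [Finset.sum_eq_single n]
    · simp
    · intro m _ hm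
      rw [if_neg fun h => hm (Fin.ext h.symm)]
    · simp
  rw [← hc, hP0]; simp

theorem integral_norm_sq_freqResponse_pos {N : ℕ} {a b : ℝ} (hab : a < b) (hb : b < a + 1)
    {v : Fin N → ℂ} (hv : v ≠ 0) : 0 < ∫ f in a..b, ‖freqResponse v f‖ ^ 2 := by
  obtain ⟨f, hf, hne⟩ := exists_freqResponse_ne_zero hab hb hv
  refine intervalIntegral.integral_pos hab (Continuous.continuousOn (by fun_prop))
    (fun _ _ => by positivity) ⟨f, hf, ?_⟩
  have := norm_pos_iff.mpr hne
  positivity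

/-- β is the energy in [-W, W] and 1 - β the energy in [W, 1 - W]; neither can vanish for a nonzero
vector. -/
theorem IsProlateEigenvector.mem_Ioo {N : ℕ} {W β : ℝ} {v : Fin N → ℝ} (hW0 : 0 < W)
    (hW1 : W < 1 / 2) (hv : IsProlateEigenvector W β v) (h1 : ∑ n, v n ^ 2 = 1) :
    0 < β ∧ β < 1 := by
  have hv0 : (fun n => (v n : ℂ)) ≠ 0 := by
    intro h
    have : ∀ n, v n = 0 := fun n => by simpa using congrFun h n
    simp [this] at h1
  have hin := hv.integral_norm_sq
  rw [h1, mul_one] at hin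
  have hpos := integral_norm_sq_freqResponse_pos (a := -W) (b := W) (by linarith) (by linarith) hv0
  have hout := integral_norm_sq_freqResponse_pos (a := W) (b := 1 - W) (by linarith)
    (by linarith) hv0
  have htot := integral_norm_sq_add_le (fun n => (v n : ℂ)) (a := -W) (b := W) (c := W)
    (d := 1 - W) (e := -W) le_rfl le_rfl (by linarith)
  have hn : ∑ n, ‖(v n : ℂ)‖ ^ 2 = 1 := by simpa using h1
  rw [hn] at htot
  constructor <;> linarith

/-- The tridiagonal matrix as a real matrix. -/
def tridiagMatrix (N : ℕ) (W : ℝ) : Matrix (Fin N) (Fin N) ℝ :=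
  Matrix.of fun i j => tridiag N W ((i : ℕ) : ℤ) ((j : ℕ) : ℤ)

theorem isHermitian_tridiagMatrix (N : ℕ) (W : ℝ) : (tridiagMatrix N W).IsHermitian := by
  ext i j
  simp [tridiagMatrix, tridiag_symm N W ((j : ℕ) : ℤ)]

/-- An orthonormal family of prolate eigenvectors with distinct eigenvalues. -/
theorem exists_prolate_eigenbasis (N : ℕ) {W : ℝ} (hW0 : 0 < W) (hW1 : W < 1 / 2) :
    ∃ (β : Fin N → ℝ) (t : Fin N → Fin N → ℝ), Function.Injective β ∧
      (∀ i, IsProlateEigenvector W (β i) (t i)) ∧ ∀ i, ∑ n, t i n ^ 2 = 1 := by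
  have hT := isHermitian_tridiagMatrix N W
  set b := hT.eigenvectorBasis with hb
  set t : Fin N → Fin N → ℝ := fun i n => b i n with ht
  have horth : ∀ i j, ∑ n, t i n * t j n = if i = j then 1 else 0 := by
    intro i j
    have := orthonormal_iff_ite.mp b.orthonormal i j
    rw [← this, PiLp.inner_apply]
    simp [ht, mul_comm]
  have hcomplete : ∀ y : Fin N → ℝ, (∀ k, ∑ n, t k n * y n = 0) → y = 0 := by
    intro y hy
    have h : WithLp.toLp 2 y = 0 := by
      apply b.repr.injective
      ext k
      rw [map_zero, b.repr_apply_apply, PiLp.inner_apply]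
      simpa [ht, mul_comm] using hy k
    simpa using congrArg WithLp.ofLp h
  have hsq : ∀ i, ∑ n, t i n ^ 2 = 1 := fun i => by
    have := horth i i
    rw [if_pos rfl] at this
    rw [← this]
    exact Finset.sum_congr rfl fun _ _ => by ring
  have hne : ∀ i, t i ≠ 0 := fun i h => by
    have := hsq i
    rw [h] at this
    simp at this
  have htri : ∀ i, IsTridiagEigenvector W (hT.eigenvalues i) (t i) := by
    intro i m
    have := congrFun (hT.mulVec_eigenvectorBasis i) m
    simpa [Matrix.mulVec, dotProduct, tridiagMatrix, ht, hb] using this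
  -- B maps each eigenline of T into itself.
  have hpro : ∀ i, ∃ β, IsProlateEigenvector W β (t i) := fun i =>
    (htri i).prolateApply.exists_eq_smul (htri i) (hne i)
  choose β hβ using hpro
  choose σ hσ hpar using fun i => (htri i).exists_parity (hne i)
  exact ⟨β, t, prolate_eigenvalues_injective horth hcomplete hβ hσ hpar
    fun i => (htri i).edge_ne_zero hW0 hW1 (hne i), hβ, hsq⟩

theorem exists_isDPSS (N : ℕ) {W : ℝ} (hW0 : 0 < W) (hW1 : W < 1 / 2) :
    ∃ (lam : Fin N → ℝ) (s : Fin N → ℤ → ℝ), IsDPSS N W lam s := by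
  obtain ⟨β, t, hinj, ht, hsq⟩ := exists_prolate_eigenbasis N hW0 hW1
  -- `Tuple.sort` is increasing, so the reversal produces decreasing eigenvalues.
  set π : Fin N → Fin N := fun l => Tuple.sort β l.rev with hπ
  have hmono : StrictMono (β ∘ Tuple.sort β) :=
    (Tuple.monotone_sort β).strictMono_of_injective (hinj.comp (Tuple.sort β).injective)
  have hβ : ∀ i, 0 < β i ∧ β i < 1 := fun i => (ht i).mem_Ioo hW0 hW1 (hsq i)
  -- The eigenvalue equation forces this extension to ℤ; on 0, …, N-1 it returns the eigenvector
  -- itself.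
  set s : Fin N → ℤ → ℝ := fun l n =>
    (∑ m : Fin N, prolateKernel W (n - (m : ℕ)) * t (π l) m) / β (π l) with hs
  have hst : ∀ l (n : Fin N), s l ((n : ℕ) : ℤ) = t (π l) n := by
    intro l n
    simp only [hs]
    rw [ht (π l) n, mul_div_cancel_left₀ _ (hβ _).1.ne']
  refine ⟨fun l => β (π l), s, fun l => (hβ _).2, ?_, fun l => (hβ _).1, ?_, ?_⟩
  · intro l l' hl
    exact hmono (Fin.rev_lt_rev.mpr hl)
  · intro l
    funext n
    rw [bandLimit_timeLimit]
    simp only [hst]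
    have : β (π l) * s l n = ∑ m : Fin N, prolateKernel W (n - (m : ℕ)) * t (π l) m := by
      simp only [hs]
      rw [mul_div_cancel₀ _ (hβ _).1.ne']
    exact_mod_cast this.symm
  · intro l
    rw [Real.sqrt_eq_one, tsum_norm_sq_timeLimit]
    simp only [hst]
    simpa using hsq (π l)

end

theorem mainTheorem10 :
    -- the DPSS's exist
    (∀ (N : ℕ) (W : ℝ), 0 < W → W < 1 / 2 →
      ∃ (lam : Fin N → ℝ) (s : Fin N → ℤ → ℝ), IsDPSS N W lam s) ∧
    -- the constants exist; `C₁` is absolute, `C₂` and `N₀` depend only on `W` and `ε`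
    (∃ C₁ : ℝ, 0 < C₁ ∧ ∀ W ε : ℝ, 0 < W → W < 1 / 2 → 0 < ε → ε < 1 →
      ∃ C₂ : ℝ, 0 < C₂ ∧ ∃ N₀ : ℕ, ClusterNearOne W ε C₁ C₂ N₀) ∧
    -- the near-isometry, for every valid choice of the constants
    (∀ (Bnyq Bband Ts W ε C₁ C₂ : ℝ) (J N₀ N k : ℕ) (hkN : k ≤ N)
      (lam : Fin N → ℝ) (s : Fin N → ℤ → ℝ),
      0 < Bnyq → 0 < Bband → (J : ℝ) = Bnyq / Bband →
      0 < Ts → Ts ≤ 1 / Bnyq →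
      W = Bband * Ts / 2 → W < 1 / 2 →
      0 < ε → ε < 1 →
      ClusterNearOne W ε C₁ C₂ N₀ →
      1 ≤ N → N₀ ≤ N →
      IsDPSS N W lam s →
      k = ⌊2 * N * W * (1 - ε)⌋₊ →
      k * J < N ∧
      ∀ α : EuclideanSpace ℂ (Fin J × Fin k), α ≠ 0 →
        Real.sqrt (1 - 3 * N * Real.sqrt C₁ * Real.exp (-(C₂ * N / 2))) ≤
          ‖Matrix.toEuclideanLin (multibandDictionary Bnyq Bband Ts J hkN s) α‖ / ‖α‖ ∧
        ‖Matrix.toEuclideanLin (multibandDictionary Bnyq Bband Ts J hkN s) α‖ / ‖α‖ ≤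
          Real.sqrt (1 + 3 * N * Real.sqrt C₁ * Real.exp (-(C₂ * N / 2)))) := by
  refine ⟨fun N W hW0 hW1 => exists_isDPSS N hW0 hW1,
    ⟨1, one_pos, fun W ε hW0 hW1 hε0 hε1 => exists_clusterNearOne hW0 hW1 hε0 hε1⟩, ?_⟩
  intro Bnyq Bband Ts W ε C₁ C₂ J N₀ N k hkN lam s h1 h2 h3 h4 h5 h6 _ h8 h9 h10 h11 h12 h13 h14
  exact multibandDictionary_near_isometry Bnyq Bband Ts W ε C₁ C₂ J N₀ N k hkN lam s h1 h2 h3 h4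
    h5 h6 h8 h9 h10 h11 h12 h13 h14
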